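/- Let $k\ge 1$ be an integer, $M=2^k$, $\mu\in(0,1)$, $p_a\in(0,1]$, $\epsilon\in(0,1]$. At blocklength $n$ there are $K=K_n$ users, of which $K_a=K_{a,n}\le K_n$ are active, where $K_n/n\to\mu$ and $K_{a,n}/K_n\to p_a$ as $n\to\infty$ (that is, $K=\mu n$ and $K_a=p_aK$ up to rounding). The set $\mathcal K_a$ of active users is uniformly distributed among the $K_a$-subsets of $[K]$. User $j$ has its own codebook $\mathbf c^j_1,\dots,\mathbf c^j_M\in\mathbb C^n$ with $\|\mathbf c^j_m\|_2^2\le nP$ and a (possibly randomized) encoder from $[M]$ to its codebook, and the messages $W_j$ are independent and uniform on $[M]$. The receiver observes $\mathbf y=\sum_{j\in\mathcal K_a}h_j\mathbf c^j+\mathbf z\in\mathbb C^n$, where $\mathbf c^j$ is the codeword sent by user $j$, and the fading coefficients $h_j$ and the entries of $\mathbf z$ are i.i.d. $\mathcal{CN}(0,1)$. From $\mathbf y$ and $(h_j)_{j\in[K]}$ (CSI at the receiver), without knowing $\mathcal K_a$, a (possibly randomized) decoder declares $K_a$ users active and outputs an estimate $\hat W_j\in[M]$ for each of them, and an error symbol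 for every other user. An $(n,M,\epsilon_n,\varepsilon,K,K_a)$ code is such a scheme with energy-per-bit $nP/k=\varepsilon$ and per-user probability of error $$P_e=\mathbb E\Big[\frac1{K_a}\sum_{j\in\mathcal K_a}1[W_j\ne\hat W_j]\Big]\le\epsilon_n .$$ Let $\varepsilon^*(M,\mu,p_a,\epsilon)=\limsup_{n\to\infty}\inf\{\varepsilon:\text{there is an }(n,M,\epsilon,\varepsilon,K,K_a)\text{ code}\}$. Let $S=p_a\mu k$ be the spectral efficiency, $\nu\in(1-\epsilon,1]$, $\epsilon'=\epsilon-1+\nu$, $h(p)=-p\ln p-(1-p)\ln(1-p)$, $\xi(\varsigma,\zeta)=\varsigma\ln\varsigma-\zeta\ln\zeta+\zeta-\varsigma$ (with $0\ln 0=0$), $$\gamma_\theta=p_a\mu\,h(1-\nu+\theta)+\mu(1-\nu p_a+\theta p_a)\,h\Big(\frac{\theta p_a}{1+\theta p_a-\nu p_a}\Big)+\theta p_a\mu\ln M,$$ $$P'_{tot,a}(\theta,\psi)=\frac{4(e^{\gamma_\theta}-1)}{\xi(\psi,\psi+\theta)-4(e^{\gamma_\theta}-1)\,\xi(\psi+\theta,\psi+\theta+1-\nu)},$$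 where $P'_{tot,a}(\theta,\psi)=+\infty$ if the denominator is not positive, and $$\varepsilon^*_{CSIR}=\sup_{\theta\in(\epsilon',\nu]}\ \sup_{\psi\in[0,\nu-\theta]}\frac{P'_{tot,a}(\theta,\psi)}{S}$$ (a supremum in $[0,\infty]$, equal to $0$ if the index set is empty, i.e. if $\epsilon=1$). If $\varepsilon\in[0,\infty)$ and $\varepsilon>\varepsilon^*_{CSIR}$, then there is a sequence of $(n,M,\epsilon_n,\varepsilon,K,K_a)$ codes with $\limsup_{n\to\infty}\epsilon_n\le\epsilon$. Hence $\varepsilon^*(M,\mu,p_a,\epsilon)\le\varepsilon^*_{CSIR}$. -/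

import Mathlib

open MeasureTheory ProbabilityTheory Filter Topology
open scoped NNReal ENNReal

noncomputable section

namespace MassiveAccess

/-- The circularly symmetric complex Gaussian law `CN(0,1)`: real and imaginary parts are
independent real Gaussians of mean `0` and variance `1/2`. -/
def stdComplexGaussian : Measure ℂ :=
  ((gaussianReal 0 (1 / 2)).prod (gaussianReal 0 (1 / 2))).map
    (fun p : ℝ × ℝ => (⟨p.1, p.2⟩ : ℂ))

/-- The law of a vector with `m` i.i.d. `CN(0,1)` entries. -/
def stdComplexGaussianVec (m : ℕ) : Measure (Fin m → ℂ) :=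
  Measure.pi fun _ => stdComplexGaussian

/-- An output of the decoder: an estimate `Ŵ_j` for every user `j`, where `none` is the error
symbol `?` (user not declared active), such that exactly `Ka` users receive a message. -/
def DecoderOutput (k K Ka : ℕ) : Type :=
  {w : Fin K → Option (Fin (2 ^ k)) //
    (Finset.univ.filter fun j => (w j).isSome = true).card = Ka}

instance (k K Ka : ℕ) : Fintype (DecoderOutput k K Ka) := by
  unfold DecoderOutput; infer_instance

/-- Codebooks, (possibly randomized) encoders and a (possibly randomized) decoder, of blocklength
`n`, for `K` users of which `Ka` are active, each with `M = 2 ^ k` messages. The decoder does not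
know which users are active; it knows the received signal and the realization of the fading
coefficients of all `K` users (CSI at the receiver). The encoders know neither the fading
coefficients nor each other's randomness. -/
structure Scheme (n k K Ka : ℕ) where
  /-- `codebook j m` is the codeword `c_m^j`. -/
  codebook : Fin K → Fin (2 ^ k) → Fin n → ℂ
  /-- `encoder j m` is the law of the index of the codeword that user `j` sends for message `m`. -/
  encoder : Fin K → Fin (2 ^ k) → PMF (Fin (2 ^ k))
  /-- `decoder (y, h)` is the law of the output when `y` is received and `h` is the fading. -/
  decoder : (Fin n → ℂ) × (Fin K → ℂ) → PMF (DecoderOutput k K Ka)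
  measurable_decoder : ∀ w, Measurable fun p => decoder p w

namespace Scheme

variable {n k K Ka : ℕ}

/-- The received signal `y = ∑_{j ∈ A} h_j c^j + z` if `A` is the active set and user `j` sends
the codeword of index `x j`. -/
def received (C : Scheme n k K Ka) (A : Finset (Fin K)) (x : Fin K → Fin (2 ^ k))
    (h : Fin K → ℂ) (z : Fin n → ℂ) : Fin n → ℂ :=
  fun i => ∑ j ∈ A, h j * C.codebook j (x j) i + z i

/-- The power constraint `‖c_m^j‖₂² ≤ n P` for all codewords. -/
def PowerConstraint (C : Scheme n k K Ka) (P : ℝ) : Prop :=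
  ∀ j m, ∑ i, ‖C.codebook j m i‖ ^ 2 ≤ n * P

/-- The fraction of active users whose message is not decoded correctly. -/
def errorFraction (A : Finset (Fin K)) (W : Fin K → Fin (2 ^ k))
    (w : DecoderOutput k K Ka) : ℝ≥0∞ :=
  ((A.filter fun j => w.1 j ≠ some (W j)).card : ℝ≥0∞) / Ka

/-- The expected fraction of errors, given the active set `A`, the messages `W` and the indices
`x` of the sent codewords; the expectation is over the fading coefficients (i.i.d. `CN(0,1)`), the
noise (i.i.d. `CN(0,1)`) and the randomness of the decoder. -/
def condError (C : Scheme n k K Ka) (A : Finset (Fin K)) (W x : Fin K → Fin (2 ^ k)) : ℝ≥0∞ :=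
  ∫⁻ h, ∫⁻ z, ∑ w, C.decoder (C.received A x h z, h) w * errorFraction A W w
    ∂(stdComplexGaussianVec n) ∂(stdComplexGaussianVec K)

/-- The per-user probability of error
`P_e = 𝔼 [(1 / Ka) ∑_{j active} 1[W_j ≠ Ŵ_j]]`: the active set is uniform among the sets of `Ka`
users, the messages are independent and uniform on `[M]`, and the users randomize their encoders
independently. -/
def pupe (C : Scheme n k K Ka) : ℝ≥0∞ :=
  (∑ A ∈ Finset.powersetCard Ka (Finset.univ : Finset (Fin K)),
    (∑ W : Fin K → Fin (2 ^ k), ∑ x : Fin K → Fin (2 ^ k),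
      (∏ j, C.encoder j (W j) (x j)) * C.condError A W x) / ((2 : ℝ≥0∞) ^ k) ^ K)
    / (K.choose Ka : ℝ≥0∞)

end Scheme

/-- There is an `(n, M, ϵ, e, K, Ka)` random access code (with CSIR), where `M = 2 ^ k`: the power
is `P = e k / n`, i.e. the energy-per-bit is `e = n P / k`, and the PUPE is at most `ϵ`. -/
def ExistsCode (n k : ℕ) (ϵ : ℝ≥0∞) (e : ℝ≥0) (K Ka : ℕ) : Prop :=
  ∃ C : Scheme n k K Ka, C.PowerConstraint ((e : ℝ) * k / n) ∧ C.pupe ≤ ϵ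

/-- The minimum energy-per-bit `ε*` for `M = 2 ^ k` and target PUPE `ϵ`, when there are `K n` users
and `Ka n` active users at blocklength `n` (upper limit as `n → ∞`; `∞` if there are no codes). -/
def minEnergyPerBit (k : ℕ) (K Ka : ℕ → ℕ) (ϵ : ℝ≥0∞) : ℝ≥0∞ :=
  limsup (fun n => ⨅ (e : ℝ≥0) (_ : ExistsCode n k ϵ e (K n) (Ka n)), (e : ℝ≥0∞)) atTop

/-- `ξ(ς, ζ) = ς ln ς - ζ ln ζ + ζ - ς` (with `0 ln 0 = 0`). -/
def xi (s t : ℝ) : ℝ :=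
  s * Real.log s - t * Real.log t + t - s

/-- The exponent `γ_θ`, with `M = 2 ^ k`; `Real.binEntropy` is the binary entropy in nats. -/
def gammaExp (k : ℕ) (μ pa ν θ : ℝ) : ℝ :=
  pa * μ * Real.binEntropy (1 - ν + θ)
    + μ * (1 - ν * pa + θ * pa) * Real.binEntropy (θ * pa / (1 + θ * pa - ν * pa))
    + θ * pa * μ * Real.log ((2 : ℝ) ^ k)

/-- The power `P'_{tot,a}(θ, ψ)`. It is `∞` if the denominator of the formula is not positive: then
no finite power suffices for the pair `(θ, ψ)`. -/
def powerBound (k : ℕ) (μ pa ν θ ψ : ℝ) : ℝ≥0∞ :=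
  ENNReal.ofReal (4 * (Real.exp (gammaExp k μ pa ν θ) - 1)) /
    ENNReal.ofReal (xi ψ (ψ + θ)
      - 4 * (Real.exp (gammaExp k μ pa ν θ) - 1) * xi (ψ + θ) (ψ + θ + 1 - ν))

/-- The threshold `ε*_CSIR = sup_{θ ∈ (ϵ', ν]} sup_{ψ ∈ [0, ν - θ]} P'_{tot,a}(θ, ψ) / S`, where
`ϵ' = ϵ - 1 + ν` and `S = pa μ k` is the spectral efficiency. -/
def csirThreshold (k : ℕ) (μ pa ϵ ν : ℝ) : ℝ≥0∞ :=
  ⨆ θ ∈ Set.Ioc (ϵ - 1 + ν) ν, ⨆ ψ ∈ Set.Icc 0 (ν - θ),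
    powerBound k μ pa ν θ ψ / ENNReal.ofReal (pa * μ * k)

end MassiveAccess

end

noncomputable section

namespace MassiveAccess

/-! Random coding. The codewords are `s • G` with `G` i.i.d. Gaussian. The decoder picks, among all
assignments of messages to exactly `N = ⌊ν Ka⌋` users, one whose reconstruction is closest to the
received signal, and then fills up to `Ka` users arbitrarily. Since only about `ν Ka` users are
really decoded, the remaining `(1-ν) Ka` active users act as interference.

Fix the fading. Let an assignment `w` be right on a set `C` of active users and put `t = N - |C|`.
It is compared with the true messages on `C ∪ T`, where `T` consists of the `t` strongest active
users outside `C`. The two residuals differ by a Gaussian of energy at least that of `T`, seen in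
noise plus the interference of the `Ka - N` other users. Chernoff's bound (`lintegral_pairwise_le`)
says that `w` is preferred with probability at most `(1+q)^(-n)` whenever `4q (1 + interference) ≤
energy of T`. There are at most `exp (n γ_θ)` assignments with `t = θ Ka`
(`choose_mul_choose_mul_pow_le`), so a union bound with `1 + q = exp (γ_θ + η)` leaves at most `(N +
1) exp (-nη)`.

The energies are controlled uniformly in `C`. The squared gains `‖h j‖ ^ 2` are exponential
variables, and `xi s t` is the integral of `-ln` over `[s, t]`, that is, the normalized sum of their
order statistics ranked between the fractions `s` and `t`. If `m` is the rank among all active users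
of the weakest user in `T`, then with `ψ = (m-t)/Ka` the energy of `T` is at least about `Ka ξ(ψ,
ψ+θ)` and the interference is at most about `Ka ξ(ψ+θ, ψ+θ+1-ν)` (`ExcessClose.exists_split`). This
is why the threshold is a supremum over `ψ`.

Above the threshold the required inequality holds strictly on the compact closure of the set of
pairs `(θ, ψ)`, hence with a uniform margin that survives rounding and fluctuations
(`exists_uniform_margin`). Averaging over the codebook, together with a bound for codewords of
excessive power, gives a code for all large `n`. -/

instance : IsProbabilityMeasure stdComplexGaussian :=
  Measure.isProbabilityMeasure_map
    (Complex.measurableEquivRealProd.symm.measurable.aemeasurable)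

instance (m : ℕ) : IsProbabilityMeasure (stdComplexGaussianVec m) := by
  unfold stdComplexGaussianVec; infer_instance

/-! ### Exponential moments of squared norms of Gaussian combinations. -/

theorem lintegral_stdComplexGaussian {f : ℂ → ℝ≥0∞} (hf : Measurable f) :
    ∫⁻ g, f g ∂stdComplexGaussian
      = ∫⁻ x, ∫⁻ y, f ⟨x, y⟩ ∂gaussianReal 0 (1 / 2) ∂gaussianReal 0 (1 / 2) := by
  have hm : Measurable (fun p : ℝ × ℝ => (⟨p.1, p.2⟩ : ℂ)) :=
    Complex.measurableEquivRealProd.symm.measurable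
  rw [stdComplexGaussian, lintegral_map hf hm]
  exact lintegral_prod _ (hf.comp hm).aemeasurable

/-- Completing the square turns the density times the integrand into a constant times the Gaussian
density of mean `-β p / (1 + β)` and variance `1 / (2 (1 + β))`. Negative `β > -1` is allowed, and
the Chernoff bounds need it. -/
theorem lintegral_exp_neg_mul_sq_gaussianReal {β : ℝ} (hβ : 0 < 1 + β) (p : ℝ) :
    ∫⁻ x, ENNReal.ofReal (Real.exp (-β * (p + x) ^ 2)) ∂gaussianReal 0 (1 / 2)
      = ENNReal.ofReal ((√(1 + β))⁻¹ * Real.exp (-β * p ^ 2 / (1 + β))) := by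
  set v : ℝ≥0 := ⟨1 / (2 * (1 + β)), by positivity⟩ with hv
  have hvc : (v : ℝ) = 1 / (2 * (1 + β)) := rfl
  have hv0 : v ≠ 0 := by
    rw [← NNReal.coe_ne_zero, hvc]; positivity
  have key : ∀ x, gaussianPDF 0 (1 / 2) x * ENNReal.ofReal (Real.exp (-β * (p + x) ^ 2))
      = ENNReal.ofReal ((√(1 + β))⁻¹ * Real.exp (-β * p ^ 2 / (1 + β)))
        * gaussianPDF (-β * p / (1 + β)) v x := by
    intro x
    rw [gaussianPDF, gaussianPDF, ← ENNReal.ofReal_mul (gaussianPDFReal_nonneg _ _ _),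
      ← ENNReal.ofReal_mul (by positivity)]
    congr 1
    rw [gaussianPDFReal, gaussianPDFReal, hvc]
    have h1 : (√(2 * Real.pi * (1 / (2 * (1 + β)))))⁻¹ = √(1 + β) * (√Real.pi)⁻¹ := by
      rw [show 2 * Real.pi * (1 / (2 * (1 + β))) = Real.pi / (1 + β) by field_simp,
        Real.sqrt_div Real.pi_pos.le, inv_div, div_eq_mul_inv]
    have h2 : (√(2 * Real.pi * ((1 / 2 : ℝ≥0) : ℝ)))⁻¹ = (√Real.pi)⁻¹ := by
      congr 2; push_cast; ring
    have h3 : 0 < √(1 + β) := Real.sqrt_pos.2 hβ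
    rw [h1, h2]
    have h4 : Real.exp (-(x - 0) ^ 2 / (2 * ((1 / 2 : ℝ≥0) : ℝ))) * Real.exp (-β * (p + x) ^ 2)
        = Real.exp (-β * p ^ 2 / (1 + β))
          * Real.exp (-(x - -β * p / (1 + β)) ^ 2 / (2 * (1 / (2 * (1 + β))))) := by
      rw [← Real.exp_add, ← Real.exp_add]
      congr 1
      push_cast
      field_simp
      ring
    rw [mul_assoc, h4]
    field_simp
  rw [gaussianReal_of_var_ne_zero _ (by norm_num), lintegral_withDensity_eq_lintegral_mul _
    (measurable_gaussianPDF _ _) (by fun_prop)]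
  simp only [Pi.mul_apply, key]
  rw [lintegral_const_mul _ (measurable_gaussianPDF _ _), lintegral_gaussianPDF_eq_one _ hv0,
    mul_one]

theorem lintegral_exp_neg_mul_norm_add_sq {β : ℝ} (hβ : 0 < 1 + β) (u : ℂ) :
    ∫⁻ g, ENNReal.ofReal (Real.exp (-β * ‖u + g‖ ^ 2)) ∂stdComplexGaussian
      = ENNReal.ofReal ((1 + β)⁻¹ * Real.exp (-β * ‖u‖ ^ 2 / (1 + β))) := by
  rw [lintegral_stdComplexGaussian (by fun_prop)]
  have key : ∀ x y : ℝ, ENNReal.ofReal (Real.exp (-β * ‖u + ⟨x, y⟩‖ ^ 2))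
      = ENNReal.ofReal (Real.exp (-β * (u.re + x) ^ 2))
        * ENNReal.ofReal (Real.exp (-β * (u.im + y) ^ 2)) := by
    intro x y
    rw [← ENNReal.ofReal_mul (by positivity), ← Real.exp_add, ← Complex.normSq_eq_norm_sq,
      Complex.normSq_apply]
    congr 2
    simp only [Complex.add_re, Complex.add_im]
    ring
  simp only [key]
  simp_rw [lintegral_const_mul' _ _ ENNReal.ofReal_ne_top,
    lintegral_exp_neg_mul_sq_gaussianReal hβ]
  rw [lintegral_mul_const' _ _ ENNReal.ofReal_ne_top, lintegral_exp_neg_mul_sq_gaussianReal hβ,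
    ← ENNReal.ofReal_mul (by positivity)]
  congr 1
  have h3 : √(1 + β) * √(1 + β) = 1 + β := Real.mul_self_sqrt hβ.le
  rw [mul_mul_mul_comm, ← mul_inv, h3, ← Real.exp_add, ← Complex.normSq_eq_norm_sq,
    Complex.normSq_apply]
  congr 2
  ring

theorem lintegral_exp_neg_mul_norm_add_mul_sq {α : ℝ} {a : ℂ} (h : 0 < 1 + α * ‖a‖ ^ 2) (u : ℂ) :
    ∫⁻ g, ENNReal.ofReal (Real.exp (-α * ‖u + a * g‖ ^ 2)) ∂stdComplexGaussian
      = ENNReal.ofReal ((1 + α * ‖a‖ ^ 2)⁻¹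
          * Real.exp (-α * ‖u‖ ^ 2 / (1 + α * ‖a‖ ^ 2))) := by
  rcases eq_or_ne a 0 with rfl | ha
  · simp
  have e : ∀ g, -α * ‖u + a * g‖ ^ 2 = -(α * ‖a‖ ^ 2) * ‖u / a + g‖ ^ 2 := by
    intro g
    rw [show u + a * g = a * (u / a + g) by field_simp, norm_mul]
    ring
  simp_rw [e]
  rw [lintegral_exp_neg_mul_norm_add_sq h]
  have : ‖a‖ ≠ 0 := norm_ne_zero_iff.2 ha
  rw [norm_div]
  congr 3
  field_simp

section Marginal

variable {ι : Type*} [Fintype ι] [DecidableEq ι]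

omit [Fintype ι] in
-- The coordinates are integrated out one at a time: integrating those of `T` replaces `α` by `α /
-- (1 + α ∑ ‖a j‖ ^ 2)`, and the prefactors telescope to a single one.
theorem lmarginal_exp_neg_mul_norm_add_sum_sq {α : ℝ} (a : ι → ℂ) (T : Finset ι)
    (h : 0 < 1 + α * ∑ j ∈ T, ‖a j‖ ^ 2) (x : ι → ℂ) (u : ℂ) :
    (∫⋯∫⁻_T, fun g => ENNReal.ofReal (Real.exp (-α * ‖u + ∑ j ∈ T, a j * g j‖ ^ 2))
        ∂fun _ => stdComplexGaussian) x
      = ENNReal.ofReal ((1 + α * ∑ j ∈ T, ‖a j‖ ^ 2)⁻¹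
          * Real.exp (-α * ‖u‖ ^ 2 / (1 + α * ∑ j ∈ T, ‖a j‖ ^ 2))) := by
  induction T using Finset.induction_on generalizing x u with
  | empty => simp
  | insert i T hi ih =>
    have hpos : 0 < 1 + α * ∑ j ∈ T, ‖a j‖ ^ 2 := by
      rw [Finset.sum_insert hi] at h
      have h1 : 0 ≤ ‖a i‖ ^ 2 := by positivity
      have h2 : 0 ≤ ∑ j ∈ T, ‖a j‖ ^ 2 := by positivity
      rcases le_or_gt 0 α with h0 | h0
      · positivity
      · nlinarith
    rw [lmarginal_insert _ (by fun_prop) hi]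
    have e : ∀ xi : ℂ, (∫⋯∫⁻_T, fun g => ENNReal.ofReal
          (Real.exp (-α * ‖u + ∑ j ∈ insert i T, a j * g j‖ ^ 2))
            ∂fun _ => stdComplexGaussian) (Function.update x i xi)
        = (∫⋯∫⁻_T, fun g => ENNReal.ofReal
          (Real.exp (-α * ‖(u + a i * xi) + ∑ j ∈ T, a j * g j‖ ^ 2))
            ∂fun _ => stdComplexGaussian) (Function.update x i xi) := by
      intro xi
      rw [lmarginal, lmarginal]
      refine lintegral_congr fun y => ?_
      rw [Finset.sum_insert hi, Function.updateFinset]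
      simp only [hi, dite_false, Function.update_self]
      rw [add_assoc]
    simp_rw [e, ih hpos]
    set s := 1 + α * ∑ j ∈ T, ‖a j‖ ^ 2 with hs
    have hs' : 1 + α * ∑ j ∈ insert i T, ‖a j‖ ^ 2 = s + α * ‖a i‖ ^ 2 := by
      rw [Finset.sum_insert hi, hs]; ring
    have h' : 0 < 1 + α / s * ‖a i‖ ^ 2 := by
      rw [hs'] at h
      rw [show 1 + α / s * ‖a i‖ ^ 2 = (s + α * ‖a i‖ ^ 2) / s by field_simp]
      positivity
    simp_rw [ENNReal.ofReal_mul (inv_nonneg.2 hpos.le)]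
    rw [lintegral_const_mul' _ _ ENNReal.ofReal_ne_top]
    have e2 : ∀ xi : ℂ, -α * ‖u + a i * xi‖ ^ 2 / s = -(α / s) * ‖u + a i * xi‖ ^ 2 := by
      intro xi; ring
    simp_rw [e2]
    rw [lintegral_exp_neg_mul_norm_add_mul_sq h', ← ENNReal.ofReal_mul (inv_nonneg.2 hpos.le),
      hs', ← mul_assoc, ← mul_inv]
    rw [hs'] at h
    have e3 : s * (1 + α / s * ‖a i‖ ^ 2) = s + α * ‖a i‖ ^ 2 := by field_simp
    rw [e3, ← e3]
    congr 3
    field_simp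

/-- Chernoff's integral for the comparison of two squared distances, with independent Gaussian
perturbations indexed by the disjoint sets `T` and `R`. -/
theorem lintegral_exp_norm_sub_norm {lam : ℝ} (a : ι → ℂ) {T R : Finset ι} (hTR : Disjoint T R)
    (c : ℂ) (hlam : 0 < lam)
    (h : 0 < 1 + lam * ∑ j ∈ T, ‖a j‖ ^ 2
      - lam ^ 2 * (∑ j ∈ T, ‖a j‖ ^ 2) * (‖c‖ ^ 2 + ∑ j ∈ R, ‖a j‖ ^ 2)) :
    ∫⁻ z, ∫⁻ g : ι → ℂ, ENNReal.ofReal (Real.exp (-lam * ‖c * z + ∑ j ∈ R, a j * g j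
          + ∑ j ∈ T, a j * g j‖ ^ 2 + lam * ‖c * z + ∑ j ∈ R, a j * g j‖ ^ 2))
        ∂(Measure.pi fun _ => stdComplexGaussian) ∂stdComplexGaussian
      = ENNReal.ofReal (1 + lam * ∑ j ∈ T, ‖a j‖ ^ 2
      - lam ^ 2 * (∑ j ∈ T, ‖a j‖ ^ 2) * (‖c‖ ^ 2 + ∑ j ∈ R, ‖a j‖ ^ 2))⁻¹ := by
  set σ := ∑ j ∈ T, ‖a j‖ ^ 2 with hσ
  set ρ := ∑ j ∈ R, ‖a j‖ ^ 2 with hρ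
  have hσ0 : 0 ≤ σ := by positivity
  have hρ0 : 0 ≤ ρ := by positivity
  have h1 : 0 < 1 + lam * σ := by positivity
  -- Integrating over `T` turns the difference of squared norms into `-α ‖w‖ ^ 2`, where `w` is the
  -- residual from the noise and `R`. This `α` is at most zero, so convergence of the remaining
  -- integral is what the positivity hypothesis secures, through the factorization `hprod`.
  set α := -(lam ^ 2 * σ / (1 + lam * σ)) with hα
  have hα0 : α ≤ 0 := by rw [hα, neg_nonpos]; positivity
  have hprod : (1 + lam * σ) * (1 + α * (‖c‖ ^ 2 + ρ))
      = 1 + lam * σ - lam ^ 2 * σ * (‖c‖ ^ 2 + ρ) := by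
    rw [hα]; field_simp; ring
  have h2 : 0 < 1 + α * (‖c‖ ^ 2 + ρ) := by
    rw [← hprod] at h
    exact (mul_pos_iff_of_pos_left h1).1 h
  have h3 : 0 < 1 + α * ρ := by nlinarith [sq_nonneg ‖c‖]
  have h4 : 0 < 1 + α / (1 + α * ρ) * ‖c‖ ^ 2 := by
    rw [show 1 + α / (1 + α * ρ) * ‖c‖ ^ 2 = (1 + α * (‖c‖ ^ 2 + ρ)) / (1 + α * ρ) by
      field_simp; ring]
    positivity
  have inner : ∀ z : ℂ, ∫⁻ g : ι → ℂ, ENNReal.ofReal (Real.exp (-lam * ‖c * z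
      + ∑ j ∈ R, a j * g j + ∑ j ∈ T, a j * g j‖ ^ 2 + lam * ‖c * z + ∑ j ∈ R, a j * g j‖ ^ 2))
        ∂(Measure.pi fun _ => stdComplexGaussian)
      = ENNReal.ofReal ((1 + lam * σ)⁻¹ * (1 + α * ρ)⁻¹)
        * ENNReal.ofReal (Real.exp (-(α / (1 + α * ρ)) * ‖0 + c * z‖ ^ 2)) := by
    intro z
    set F : (ι → ℂ) → ℝ≥0∞ := fun g => ENNReal.ofReal (Real.exp (-lam * ‖c * z
      + ∑ j ∈ R, a j * g j + ∑ j ∈ T, a j * g j‖ ^ 2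
      + lam * ‖c * z + ∑ j ∈ R, a j * g j‖ ^ 2)) with hF
    have hFm : Measurable F := by rw [hF]; fun_prop
    have s1 : (∫⋯∫⁻_T, F ∂fun _ => stdComplexGaussian) = fun x =>
        ENNReal.ofReal ((1 + lam * σ)⁻¹)
          * ENNReal.ofReal (Real.exp (-α * ‖c * z + ∑ j ∈ R, a j * x j‖ ^ 2)) := by
      funext x
      set w := c * z + ∑ j ∈ R, a j * x j with hw
      have e : (∫⋯∫⁻_T, F ∂fun _ => stdComplexGaussian) x
          = ENNReal.ofReal (Real.exp (lam * ‖w‖ ^ 2)) * (∫⋯∫⁻_T, fun g => ENNReal.ofReal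
            (Real.exp (-lam * ‖w + ∑ j ∈ T, a j * g j‖ ^ 2)) ∂fun _ => stdComplexGaussian) x := by
        rw [lmarginal, lmarginal, ← lintegral_const_mul' _ _ ENNReal.ofReal_ne_top]
        refine lintegral_congr fun y => ?_
        have hR : ∑ j ∈ R, a j * Function.updateFinset x T y j = ∑ j ∈ R, a j * x j := by
          refine Finset.sum_congr rfl fun j hj => ?_
          have : j ∉ T := fun hT => Finset.disjoint_left.1 hTR hT hj
          simp [Function.updateFinset, this]
        simp only [hF]
        rw [hR, ← hw, ← ENNReal.ofReal_mul (Real.exp_nonneg _), ← Real.exp_add]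
        congr 2
        ring
      rw [e, lmarginal_exp_neg_mul_norm_add_sum_sq a T h1 x w,
        ← ENNReal.ofReal_mul (Real.exp_nonneg _),
        ← ENNReal.ofReal_mul (inv_nonneg.2 h1.le)]
      congr 1
      rw [mul_left_comm, ← Real.exp_add]
      congr 2
      rw [hα, ← hσ]
      field_simp
      ring
    have s2 : (∫⋯∫⁻_R, (∫⋯∫⁻_T, F ∂fun _ => stdComplexGaussian) ∂fun _ => stdComplexGaussian)
        = fun _ => ENNReal.ofReal ((1 + lam * σ)⁻¹) * ENNReal.ofReal ((1 + α * ρ)⁻¹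
          * Real.exp (-α * ‖c * z‖ ^ 2 / (1 + α * ρ))) := by
      funext x
      rw [s1, ← lmarginal_exp_neg_mul_norm_add_sum_sq a R h3 x (c * z), lmarginal, lmarginal,
        lintegral_const_mul' _ _ ENNReal.ofReal_ne_top]
    have hu : (Finset.univ : Finset ι) = (R ∪ T)ᶜ ∪ (R ∪ T) := by
      rw [Finset.union_comm, Finset.union_compl]
    calc ∫⁻ g, F g ∂(Measure.pi fun _ => stdComplexGaussian)
        = (∫⋯∫⁻_Finset.univ, F ∂fun _ => stdComplexGaussian) 0 := by rw [lmarginal_univ]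
      _ = _ := by
        rw [hu, lmarginal_union _ _ hFm disjoint_compl_left, lmarginal_union _ _ hFm hTR.symm, s2,
          lmarginal, lintegral_const, measure_univ, mul_one,
          ENNReal.ofReal_mul (inv_nonneg.2 h3.le), ENNReal.ofReal_mul (inv_nonneg.2 h1.le),
          mul_assoc, zero_add]
        congr 4
        ring
  simp_rw [inner]
  rw [lintegral_const_mul' _ _ ENNReal.ofReal_ne_top, lintegral_exp_neg_mul_norm_add_mul_sq h4,
    ← ENNReal.ofReal_mul (by positivity)]
  congr 1
  rw [norm_zero, ← hprod]
  simp only [ne_eq, OfNat.ofNat_ne_zero, not_false_eq_true, zero_pow, mul_zero, zero_div,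
    Real.exp_zero, mul_one, ← mul_inv]
  congr 1
  field_simp
  ring

end Marginal

/-! ### The function `xi` and sums of order statistics. -/

theorem xi_eq_sub (s t : ℝ) : xi s t = xi 0 t - xi 0 s := by
  simp only [xi]; ring

/-- Legendre duality: `xi 0 u` is the minimum over `b` of `b u + exp (-b)`, attained at `b = -log
u`; here `exp (-b)` is the mean excess of an exponential variable over `b`. -/
theorem xi_zero_le {u : ℝ} (hu : 0 ≤ u) (b : ℝ) : xi 0 u ≤ b * u + Real.exp (-b) := by
  rcases hu.eq_or_lt with rfl | hu
  · simp [xi, Real.exp_nonneg]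
  have h := Real.add_one_le_exp (-b - Real.log u)
  rw [Real.exp_sub, Real.exp_log hu, le_div_iff₀ hu] at h
  simp only [xi]
  linarith

theorem xi_zero_eq {u : ℝ} (hu : 0 < u) :
    xi 0 u = -Real.log u * u + Real.exp (-(-Real.log u)) := by
  rw [neg_neg, Real.exp_log hu]
  simp only [xi]; ring

section OrderStatistics

variable {ι : Type*} [DecidableEq ι]

theorem exists_subset_card_eq_forall_le (x : ι → ℝ) (S : Finset ι) {t : ℕ} (ht : t ≤ S.card) :
    ∃ T ⊆ S, T.card = t ∧ ∀ i ∈ T, ∀ j ∈ S \ T, x j ≤ x i := by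
  induction t with
  | zero => exact ⟨∅, by simp⟩
  | succ t ih =>
    obtain ⟨T, hTS, hT, hle⟩ := ih (by omega)
    have hne : (S \ T).Nonempty := by
      rw [← Finset.card_pos, Finset.card_sdiff_of_subset hTS]; omega
    obtain ⟨j, hj, hmax⟩ := Finset.exists_max_image (S \ T) x hne
    have hj' := Finset.mem_sdiff.1 hj
    refine ⟨insert j T, Finset.insert_subset hj'.1 hTS, by
      rw [Finset.card_insert_of_notMem hj'.2, hT], fun i hi l hl => ?_⟩
    have hl' : l ∈ S \ T := by
      simp only [Finset.mem_sdiff, Finset.mem_insert, not_or] at hl ⊢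
      exact ⟨hl.1, hl.2.2⟩
    rcases Finset.mem_insert.1 hi with rfl | hi
    · exact hmax l hl'
    · exact hle i hi l hl'

/-- The excess sums `∑_{j ∈ A} (x_j - a)⁺` are uniformly `δ`-close, after normalization, to those of
the exponential distribution. -/
def ExcessClose (A : Finset ι) (x : ι → ℝ) (δ : ℝ) : Prop :=
  ∀ a : ℝ, 0 ≤ a → |∑ j ∈ A, max (x j - a) 0 - A.card * Real.exp (-a)| ≤ A.card * δ

variable {A : Finset ι} {x : ι → ℝ} {δ : ℝ}

omit [DecidableEq ι] in
-- From `x j ≤ a + (x j - a)⁺`, any sum over `D` is at most `|D| a` plus the total excess over `a`.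
-- The level `a = -log (|D| / |A|)` is the minimizer in the duality.
theorem ExcessClose.sum_le (h : ExcessClose A x δ) {D : Finset ι} (hD : D ⊆ A)
    (hδ : 0 ≤ δ) :
    ∑ j ∈ D, x j ≤ A.card * (xi 0 (D.card / A.card) + δ) := by
  rcases D.eq_empty_or_nonempty with rfl | hne
  · simp [xi]; positivity
  have hDpos : (0 : ℝ) < D.card := by exact_mod_cast hne.card_pos
  have hle : (D.card : ℝ) ≤ A.card := by exact_mod_cast Finset.card_le_card hD
  have hApos : (0 : ℝ) < A.card := hDpos.trans_le hle
  set u : ℝ := D.card / A.card with hu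
  have hu0 : 0 < u := by positivity
  have hu1 : u ≤ 1 := by rw [hu, div_le_one hApos]; exact hle
  have ha : 0 ≤ -Real.log u := neg_nonneg.2 (Real.log_nonpos hu0.le hu1)
  have h1 := (abs_le.1 (h _ ha)).2
  rw [xi_zero_eq hu0]
  set a := -Real.log u
  have h2 : ∑ j ∈ D, x j ≤ ∑ j ∈ D, (a + max (x j - a) 0) :=
    Finset.sum_le_sum fun j _ => by linarith [le_max_left (x j - a) 0]
  have h3 : ∑ j ∈ D, max (x j - a) 0 ≤ ∑ j ∈ A, max (x j - a) 0 :=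
    Finset.sum_le_sum_of_subset_of_nonneg hD fun _ _ _ => le_max_right _ _
  rw [Finset.sum_add_distrib, Finset.sum_const, nsmul_eq_mul] at h2
  have h4 : (A.card : ℝ) * (a * u) = D.card * a := by rw [hu]; field_simp
  nlinarith

/-- If `b` separates `U` from the rest of `A`, all the excess over `b` lies in `U`, so the sum over
`U` is exactly `|U| b` plus that excess. Duality bounds this below whatever the value of `b` is, so
`b` need not be located. -/
theorem ExcessClose.le_sum (h : ExcessClose A x δ) {U : Finset ι} (hU : U ⊆ A)
    (hA : A.Nonempty) {b : ℝ} (hb : 0 ≤ b) (hUb : ∀ j ∈ U, b ≤ x j)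
    (hbU : ∀ j ∈ A \ U, x j ≤ b) :
    A.card * (xi 0 (U.card / A.card) - δ) ≤ ∑ j ∈ U, x j := by
  have hApos : (0 : ℝ) < A.card := by exact_mod_cast hA.card_pos
  have h1 := (abs_le.1 (h b hb)).1
  have h2 := xi_zero_le (u := (U.card : ℝ) / A.card) (by positivity) b
  have h3 : ∑ j ∈ A, max (x j - b) 0 = ∑ j ∈ U, (x j - b) := by
    rw [← Finset.sum_sdiff hU, Finset.sum_eq_zero, zero_add]
    · exact Finset.sum_congr rfl fun j hj => max_eq_left (by linarith [hUb j hj])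
    · exact fun j hj => max_eq_right (by linarith [hbU j hj])
  rw [h3, Finset.sum_sub_distrib, Finset.sum_const, nsmul_eq_mul] at h1
  have h4 : (A.card : ℝ) * (b * (U.card / A.card)) = U.card * b := by field_simp
  nlinarith [mul_le_mul_of_nonneg_left h2 hApos.le]

/-- `T` consists of the `t` largest entries of `S`, and `m` is the size of an upper set `U` of `A`
reaching down to the smallest entry of `T`. The sum over `T` is that over `U` minus that over `U \
T`, and the sum over `S \ T` is that over `U ∪ S \ T` minus that over `U`. Each is a difference of
two controlled sums, whence `2 * δ`. -/
theorem ExcessClose.exists_split (h : ExcessClose A x δ) (hδ : 0 ≤ δ) (hx : ∀ j, 0 ≤ x j)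
    {S : Finset ι} (hS : S ⊆ A) {t : ℕ} (ht : 0 < t) (htS : t ≤ S.card) :
    ∃ T ⊆ S, T.card = t ∧ ∃ m : ℕ, t ≤ m ∧ m + (S.card - t) ≤ A.card ∧
      A.card * (xi ((m - t : ℝ) / A.card) (m / A.card) - 2 * δ) ≤ ∑ j ∈ T, x j ∧
      ∑ j ∈ S \ T, x j
        ≤ A.card * (xi (m / A.card) ((m + (S.card - t) : ℝ) / A.card) + 2 * δ) := by
  obtain ⟨T, hTS, hT, hle⟩ := exists_subset_card_eq_forall_le x S htS
  have hTne : T.Nonempty := by rw [← Finset.card_pos, hT]; exact ht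
  obtain ⟨i, hi, hmin⟩ := Finset.exists_min_image T x hTne
  have hTA := hTS.trans hS
  have hA : A.Nonempty := hTne.mono hTA
  -- Strict inequality together with `T` itself: entries tied with the minimum of `T` stay out of
  -- `U` unless they belong to `T`, which keeps `U` disjoint from `S \ T`.
  set U := A.filter (fun j => x i < x j) ∪ T with hUdef
  have hUA : U ⊆ A := Finset.union_subset (Finset.filter_subset _ _) hTA
  have hTU : T ⊆ U := Finset.subset_union_right
  have hUST : Disjoint U (S \ T) := by
    rw [Finset.disjoint_left]
    intro j hj hj'
    rcases Finset.mem_union.1 hj with hj | hj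
    · exact absurd (hle i hi j hj') (not_le.2 (Finset.mem_filter.1 hj).2)
    · exact (Finset.mem_sdiff.1 hj').2 hj
  have hlow : A.card * (xi 0 (U.card / A.card) - δ) ≤ ∑ j ∈ U, x j := by
    refine h.le_sum hUA hA (hx i) (fun j hj => ?_) (fun j hj => ?_)
    · rcases Finset.mem_union.1 hj with hj | hj
      · exact (Finset.mem_filter.1 hj).2.le
      · exact hmin j hj
    · by_contra hlt
      have hj' := Finset.mem_sdiff.1 hj
      exact hj'.2 (Finset.mem_union_left _ (Finset.mem_filter.2 ⟨hj'.1, not_le.1 hlt⟩))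
  have hcard : (U ∪ S \ T).card = U.card + (S.card - t) := by
    rw [Finset.card_union_of_disjoint hUST, Finset.card_sdiff_of_subset hTS, hT]
  have hsub : U ∪ S \ T ⊆ A :=
    Finset.union_subset hUA (Finset.sdiff_subset.trans hS)
  have hup1 := h.sum_le (Finset.sdiff_subset.trans hUA : U \ T ⊆ A) hδ
  have hup2 := h.sum_le hsub hδ
  have htU : t ≤ U.card := hT ▸ Finset.card_le_card hTU
  rw [Finset.card_sdiff_of_subset hTU, hT, Nat.cast_sub htU] at hup1
  rw [hcard, Nat.cast_add, Nat.cast_sub htS, Finset.sum_union hUST] at hup2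
  have hsum := Finset.sum_sdiff hTU (f := x)
  refine ⟨T, hTS, hT, U.card, htU, hcard ▸ Finset.card_le_card hsub, ?_, ?_⟩
  · rw [xi_eq_sub]; linarith
  · rw [xi_eq_sub]; linarith

omit [DecidableEq ι] in
-- Both the excess sum and `|A| exp (-a)` are nonincreasing and `|A|`-Lipschitz in `a`, and beyond
-- the last grid point both are small; so finitely many levels control all.
theorem excessClose_of_grid (hδ : 0 < δ) {L : ℕ} (hL : Real.exp (-(L * (δ / 2))) ≤ δ / 2)
    (h : ∀ i ∈ Finset.range (L + 1), |∑ j ∈ A, max (x j - i * (δ / 2)) 0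
      - A.card * Real.exp (-(i * (δ / 2)))| ≤ A.card * (δ / 2)) :
    ExcessClose A x δ := by
  intro a ha
  have anti : ∀ b ≤ a, ∑ j ∈ A, max (x j - a) 0 ≤ ∑ j ∈ A, max (x j - b) 0 := fun b hb =>
    Finset.sum_le_sum fun j _ => max_le_max (by linarith) le_rfl
  have hA0 : (0 : ℝ) ≤ A.card := by positivity
  rcases le_or_gt a (L * (δ / 2)) with haL | haL
  · set i := ⌊a / (δ / 2)⌋₊ with hi
    have h1 : i * (δ / 2) ≤ a := by
      rw [← le_div_iff₀ (by positivity)]; exact Nat.floor_le (by positivity)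
    have h2 : a < (i + 1) * (δ / 2) := by
      rw [← div_lt_iff₀ (by positivity)]; exact Nat.lt_floor_add_one _
    have hiL : i ≤ L := by
      have : (i : ℝ) ≤ L := by
        have := h1.trans haL
        exact le_of_mul_le_mul_right this (by positivity)
      exact_mod_cast this
    have h3 := abs_le.1 (h i (Finset.mem_range.2 (by omega)))
    set b := i * (δ / 2) with hb
    have h4 := anti b h1
    have h5 : ∑ j ∈ A, max (x j - b) 0 - A.card * (a - b) ≤ ∑ j ∈ A, max (x j - a) 0 := by
      rw [← nsmul_eq_mul, ← Finset.sum_const, ← Finset.sum_sub_distrib]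
      refine Finset.sum_le_sum fun j _ => ?_
      rcases le_total (x j - b) 0 with h0 | h0
      · rw [max_eq_right h0]; linarith [le_max_right (x j - a) 0]
      · rw [max_eq_left h0]; linarith [le_max_left (x j - a) 0]
    have hb0 : 0 ≤ b := by positivity
    have h6 : Real.exp (-a) ≤ Real.exp (-b) := Real.exp_le_exp.2 (by linarith)
    have h7 : Real.exp (-b) ≤ Real.exp (-a) + (a - b) := by
      have e1 : Real.exp (-a) = Real.exp (-b) * Real.exp (-(a - b)) := by
        rw [← Real.exp_add]; congr 1; ring
      have e2 := Real.add_one_le_exp (-(a - b))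
      have e3 : Real.exp (-b) ≤ 1 := Real.exp_le_one_iff.2 (by linarith)
      have e4 := Real.exp_pos (-b)
      rw [e1]
      nlinarith
    rw [abs_le]
    constructor <;> nlinarith
  · have h3 := abs_le.1 (h L (Finset.mem_range.2 (by omega)))
    have h4 := anti _ haL.le
    have h5 : 0 ≤ ∑ j ∈ A, max (x j - a) 0 := Finset.sum_nonneg fun _ _ => le_max_right _ _
    have h6 : Real.exp (-a) ≤ Real.exp (-(L * (δ / 2))) := Real.exp_le_exp.2 (by linarith)
    have h7 := Real.exp_pos (-a)
    rw [abs_le]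
    constructor <;> nlinarith

end OrderStatistics

/-! ### Concentration of the fading gains. -/

theorem lintegral_stdComplexGaussian_norm_sq {F : ℝ → ℝ≥0∞} (hF : Measurable F) :
    ∫⁻ g, F (‖g‖ ^ 2) ∂stdComplexGaussian
      = ∫⁻ r in Set.Ioi (0 : ℝ), ENNReal.ofReal (2 * r * Real.exp (-r ^ 2)) * F (r ^ 2) := by
  have hpdf : ∀ x : ℝ, gaussianPDF 0 (1 / 2) x
      = ENNReal.ofReal ((√Real.pi)⁻¹ * Real.exp (-x ^ 2)) := by
    intro x
    rw [gaussianPDF, gaussianPDFReal]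
    congr 3
    · congr 1; push_cast; ring
    · push_cast; ring
  have hd : ∀ f : ℝ → ℝ≥0∞, Measurable f → ∫⁻ x, f x ∂gaussianReal 0 (1 / 2)
      = ∫⁻ x, ENNReal.ofReal ((√Real.pi)⁻¹ * Real.exp (-x ^ 2)) * f x := by
    intro f hf
    rw [gaussianReal_of_var_ne_zero _ (by norm_num), lintegral_withDensity_eq_lintegral_mul _
      (measurable_gaussianPDF _ _) hf]
    simp only [Pi.mul_apply, hpdf]
  have hns : ∀ x y : ℝ, ‖(⟨x, y⟩ : ℂ)‖ ^ 2 = x ^ 2 + y ^ 2 := by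
    intro x y
    rw [← Complex.normSq_eq_norm_sq, Complex.normSq_apply]; ring
  rw [lintegral_stdComplexGaussian (by fun_prop)]
  simp_rw [hns]
  have hm : Measurable fun x : ℝ => ∫⁻ y, F (x ^ 2 + y ^ 2) ∂gaussianReal 0 (1 / 2) :=
    Measurable.lintegral_prod_right' (f := fun p : ℝ × ℝ => F (p.1 ^ 2 + p.2 ^ 2)) (by fun_prop)
  rw [hd _ hm]
  have h2 : ∀ x : ℝ, ENNReal.ofReal ((√Real.pi)⁻¹ * Real.exp (-x ^ 2))
      * ∫⁻ y, F (x ^ 2 + y ^ 2) ∂gaussianReal 0 (1 / 2)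
      = ∫⁻ y, ENNReal.ofReal (Real.pi⁻¹ * Real.exp (-(x ^ 2 + y ^ 2))) * F (x ^ 2 + y ^ 2) := by
    intro x
    rw [hd _ (by fun_prop), ← lintegral_const_mul' _ _ ENNReal.ofReal_ne_top]
    refine lintegral_congr fun y => ?_
    rw [← mul_assoc, ← ENNReal.ofReal_mul (by positivity), mul_mul_mul_comm, ← mul_inv,
      Real.mul_self_sqrt Real.pi_pos.le, ← Real.exp_add]
    congr 4
    ring
  simp_rw [h2]
  rw [← lintegral_prod (μ := volume) (ν := volume) (fun p : ℝ × ℝ =>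
    ENNReal.ofReal (Real.pi⁻¹ * Real.exp (-(p.1 ^ 2 + p.2 ^ 2))) * F (p.1 ^ 2 + p.2 ^ 2))
    (by fun_prop), ← Measure.volume_eq_prod, ← lintegral_comp_polarCoord_symm]
  have h3 : ∀ p : ℝ × ℝ, (polarCoord.symm p).1 ^ 2 + (polarCoord.symm p).2 ^ 2 = p.1 ^ 2 := by
    intro p
    simp only [polarCoord_symm_apply]
    linear_combination p.1 ^ 2 * Real.cos_sq_add_sin_sq p.2
  simp_rw [h3, smul_eq_mul]
  rw [polarCoord_target, Measure.volume_eq_prod, setLIntegral_prod _ (by fun_prop)]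
  refine setLIntegral_congr_fun measurableSet_Ioi fun r hr => ?_
  rw [Set.mem_Ioi] at hr
  simp only [setLIntegral_const, Real.volume_Ioo]
  rw [mul_comm, ← mul_assoc, ← mul_assoc, ← ENNReal.ofReal_mul (by linarith [Real.pi_pos]),
    ← ENNReal.ofReal_mul (by nlinarith [Real.pi_pos])]
  congr 2
  have := Real.pi_pos.ne'
  field_simp
  ring

/-- `‖g‖ ^ 2` is exponential of mean one, so it exceeds `a` with probability `exp (-a)` and then by
one on average. -/
theorem lintegral_excess_stdComplexGaussian {a : ℝ} (ha : 0 ≤ a) :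
    ∫⁻ g, ENNReal.ofReal (max (‖g‖ ^ 2 - a) 0) ∂stdComplexGaussian
      = ENNReal.ofReal (Real.exp (-a)) := by
  rw [lintegral_stdComplexGaussian_norm_sq (F := fun u => ENNReal.ofReal (max (u - a) 0))
    (by fun_prop)]
  have hsa : 0 ≤ √a := Real.sqrt_nonneg a
  have hsq : √a ^ 2 = a := Real.sq_sqrt ha
  set G : ℝ → ℝ := fun r => 2 * r * Real.exp (-r ^ 2) * (r ^ 2 - a) with hG
  have hsplit : ∫⁻ r in Set.Ioi (0 : ℝ), ENNReal.ofReal (2 * r * Real.exp (-r ^ 2))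
      * ENNReal.ofReal (max (r ^ 2 - a) 0) = ∫⁻ r in Set.Ioi (√a), ENNReal.ofReal (G r) := by
    rw [← lintegral_indicator measurableSet_Ioi, ← lintegral_indicator measurableSet_Ioi]
    refine lintegral_congr fun r => ?_
    simp only [Set.indicator, Set.mem_Ioi]
    by_cases h1 : √a < r
    · have h0 : 0 < r := hsa.trans_lt h1
      rw [if_pos h0, if_pos h1, ← ENNReal.ofReal_mul (by positivity), max_eq_left]
      nlinarith
    · rw [if_neg h1]
      split_ifs with h0
      · rw [max_eq_right (by nlinarith), ENNReal.ofReal_zero, mul_zero]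
      · rfl
  -- This antiderivative vanishes at infinity and equals `-exp (-a)` at `√a`.
  have hderiv : ∀ r ∈ Set.Ici (√a),
      HasDerivAt (fun r : ℝ => -(r ^ 2 - a + 1) * Real.exp (-r ^ 2)) (G r) r := by
    intro r _
    have h1 : HasDerivAt (fun r : ℝ => -(r ^ 2 - a + 1)) (-(2 * r)) r := by
      refine (((hasDerivAt_pow 2 r).sub_const a).add_const 1).neg.congr_deriv ?_
      simp
    have h2 : HasDerivAt (fun r : ℝ => Real.exp (-r ^ 2)) (Real.exp (-r ^ 2) * -(2 * r)) r := by
      refine (hasDerivAt_pow 2 r).neg.exp.congr_deriv ?_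
      simp
    refine (h1.mul h2).congr_deriv ?_
    simp only [hG]; ring
  have hpos : ∀ r ∈ Set.Ioi (√a), 0 ≤ G r := by
    intro r hr
    have hr' : √a < r := hr
    have : 0 ≤ r ^ 2 - a := by nlinarith
    have : 0 ≤ r := hsa.trans hr'.le
    simp only [hG]; positivity
  have htend : Tendsto (fun r : ℝ => -(r ^ 2 - a + 1) * Real.exp (-r ^ 2)) atTop (𝓝 0) := by
    have hsqt : Tendsto (fun r : ℝ => r ^ 2) atTop atTop := tendsto_pow_atTop two_ne_zero
    have h1 : Tendsto (fun u : ℝ => -(u - a + 1) * Real.exp (-u)) atTop (𝓝 0) := by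
      have e1 := Real.tendsto_pow_mul_exp_neg_atTop_nhds_zero 1
      have e2 := Real.tendsto_pow_mul_exp_neg_atTop_nhds_zero 0
      have := (e2.const_mul (a - 1)).sub e1
      simp only [mul_zero, sub_zero] at this
      refine this.congr fun u => ?_
      ring
    exact h1.comp hsqt
  rw [hsplit, ← ofReal_integral_eq_lintegral_ofReal
    (integrableOn_Ioi_deriv_of_nonneg' hderiv hpos htend)
    ((ae_restrict_iff' measurableSet_Ioi).2 (Eventually.of_forall hpos)),
    integral_Ioi_of_hasDerivAt_of_nonneg' hderiv hpos htend, hsq]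
  simp

/-- Domination by an integrable exponential: `u ^ 2 ≤ 8 exp (u / 2)` for `u = ‖g‖ ^ 2`. -/
theorem memLp_excess (a : ℝ) (ha : 0 ≤ a) :
    MemLp (fun g : ℂ => max (‖g‖ ^ 2 - a) 0) 2 stdComplexGaussian := by
  rw [memLp_two_iff_integrable_sq (by fun_prop)]
  have hexp : Integrable (fun g : ℂ => 8 * Real.exp (-(-(1 / 2)) * ‖0 + g‖ ^ 2))
      stdComplexGaussian := by
    refine Integrable.const_mul ⟨by fun_prop, ?_⟩ _
    rw [hasFiniteIntegral_iff_ofReal (Eventually.of_forall fun _ => Real.exp_nonneg _),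
      lintegral_exp_neg_mul_norm_add_sq (by norm_num)]
    exact ENNReal.ofReal_lt_top
  refine hexp.mono' (by fun_prop) (Eventually.of_forall fun g => ?_)
  have h1 : 0 ≤ ‖g‖ ^ 2 := by positivity
  have h2 : max (‖g‖ ^ 2 - a) 0 ≤ ‖g‖ ^ 2 := max_le (by linarith) h1
  have h3 : 0 ≤ max (‖g‖ ^ 2 - a) 0 := le_max_right _ _
  have h4 := Real.quadratic_le_exp_of_nonneg (x := ‖g‖ ^ 2 / 2) (by positivity)
  rw [Real.norm_of_nonneg (by positivity), zero_add,
    show -(-(1 / 2 : ℝ)) * ‖g‖ ^ 2 = ‖g‖ ^ 2 / 2 by ring]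
  nlinarith

theorem integral_excess {a : ℝ} (ha : 0 ≤ a) :
    ∫ g, max (‖g‖ ^ 2 - a) 0 ∂stdComplexGaussian = Real.exp (-a) := by
  have h0 : 0 ≤ᵐ[stdComplexGaussian] fun g : ℂ => max (‖g‖ ^ 2 - a) 0 :=
    Eventually.of_forall fun _ => le_max_right _ _
  rw [integral_eq_lintegral_of_nonneg_ae h0 (by fun_prop), lintegral_excess_stdComplexGaussian ha,
    ENNReal.toReal_ofReal (Real.exp_nonneg _)]

/-- Chebyshev's inequality for a sum of `|A|` independent terms. Setting the terms outside `A` to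
zero makes it a sum over all coordinates of the product space. -/
theorem measure_excess_le {a : ℝ} (ha : 0 ≤ a) {δ : ℝ} (hδ : 0 < δ) {K : ℕ}
    {A : Finset (Fin K)} (hA : A.Nonempty) :
    stdComplexGaussianVec K {h | A.card * δ ≤
        |∑ j ∈ A, max (‖h j‖ ^ 2 - a) 0 - A.card * Real.exp (-a)|}
      ≤ ENNReal.ofReal (Var[fun g : ℂ => max (‖g‖ ^ 2 - a) 0; stdComplexGaussian] / δ ^ 2
          / A.card) := by
  have hApos : (0 : ℝ) < A.card := by exact_mod_cast hA.card_pos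
  set φ : ℂ → ℝ := fun g => max (‖g‖ ^ 2 - a) 0 with hφ
  set X : Fin K → ℂ → ℝ := fun j g => if j ∈ A then φ g else 0 with hX
  have hXm : ∀ j, MemLp (X j) 2 stdComplexGaussian := by
    intro j
    by_cases hj : j ∈ A
    · simpa [hX, hj] using memLp_excess a ha
    · simp [hX, hj]
  have hXi : ∀ j, Integrable (fun h : Fin K → ℂ => X j (h j)) (stdComplexGaussianVec K) :=
    fun j => ((hXm j).comp_measurePreserving (measurePreserving_eval _ j)).integrable (by norm_num)
  have hsum : ∀ h : Fin K → ℂ, (∑ j, fun ω : Fin K → ℂ => X j (ω j)) h = ∑ j ∈ A, φ (h j) := by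
    intro h
    rw [Finset.sum_apply, ← Finset.sum_filter]
    simp
  have hvar : Var[∑ j, fun ω : Fin K → ℂ => X j (ω j); stdComplexGaussianVec K]
      = A.card * Var[φ; stdComplexGaussian] := by
    rw [stdComplexGaussianVec, variance_sum_pi hXm]
    have : ∀ j, Var[X j; stdComplexGaussian]
        = if j ∈ A then Var[φ; stdComplexGaussian] else 0 := by
      intro j
      by_cases hj : j ∈ A
      · simp [hX, hj]
      · simp only [hX, hj, if_false]
        exact variance_zero _
    simp_rw [this]
    rw [← Finset.sum_filter]
    simp
  have hmean : ∫ h, (∑ j, fun ω : Fin K → ℂ => X j (ω j)) h ∂stdComplexGaussianVec K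
      = A.card * Real.exp (-a) := by
    simp_rw [Finset.sum_apply]
    rw [integral_finsetSum _ fun j _ => hXi j]
    have : ∀ j, ∫ h, X j (h j) ∂stdComplexGaussianVec K
        = if j ∈ A then Real.exp (-a) else 0 := by
      intro j
      rw [stdComplexGaussianVec, integral_comp_eval (μ := fun _ : Fin K => stdComplexGaussian)
        (hXm j).aestronglyMeasurable]
      by_cases hj : j ∈ A
      · simp only [hX, hj, if_true, hφ]
        exact integral_excess ha
      · simp [hX, hj]
    simp_rw [this]
    rw [← Finset.sum_filter]
    simp
  have hL : MemLp (∑ j, fun ω : Fin K → ℂ => X j (ω j)) 2 (stdComplexGaussianVec K) :=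
    memLp_finsetSum' _ fun j _ => (hXm j).comp_measurePreserving (measurePreserving_eval _ j)
  have := meas_ge_le_variance_div_sq hL (c := A.card * δ) (by positivity)
  rw [hmean, hvar] at this
  simp_rw [hsum] at this
  refine this.trans (le_of_eq ?_)
  congr 1
  field_simp

/-- A union bound over a grid that depends on `δ` only; hence `C` is the same for all `K` and `A`.
-/
theorem exists_measure_not_excessClose_le {δ : ℝ} (hδ : 0 < δ) :
    ∃ C : ℝ, ∀ (K : ℕ) (A : Finset (Fin K)), A.Nonempty →
      stdComplexGaussianVec K {h | ¬ ExcessClose A (fun j => ‖h j‖ ^ 2) δ}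
        ≤ ENNReal.ofReal (C / A.card) := by
  obtain ⟨L, hL⟩ : ∃ L : ℕ, Real.exp (-(L * (δ / 2))) ≤ δ / 2 := by
    have h1 : Tendsto (fun L : ℕ => Real.exp (-((L : ℝ) * (δ / 2)))) atTop (𝓝 0) :=
      Real.tendsto_exp_neg_atTop_nhds_zero.comp
        (tendsto_natCast_atTop_atTop.atTop_mul_const (by positivity))
    exact (h1.eventually (ge_mem_nhds (by positivity : (0 : ℝ) < δ / 2))).exists
  refine ⟨∑ i ∈ Finset.range (L + 1), Var[fun g : ℂ => max (‖g‖ ^ 2 - i * (δ / 2)) 0;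
    stdComplexGaussian] / (δ / 2) ^ 2, fun K A hA => ?_⟩
  have hsub : {h : Fin K → ℂ | ¬ ExcessClose A (fun j => ‖h j‖ ^ 2) δ}
      ⊆ ⋃ i ∈ Finset.range (L + 1), {h | A.card * (δ / 2) ≤
        |∑ j ∈ A, max (‖h j‖ ^ 2 - i * (δ / 2)) 0 - A.card * Real.exp (-(i * (δ / 2)))|} := by
    intro h hh
    by_contra hcon
    simp only [Set.mem_iUnion, Set.mem_ofPred_eq, not_exists, not_le] at hcon
    exact hh (excessClose_of_grid hδ hL fun i hi => (hcon i hi).le)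
  refine (measure_mono hsub).trans ((measure_biUnion_finset_le _ _).trans ?_)
  rw [Finset.sum_div, ENNReal.ofReal_sum_of_nonneg
    fun i _ => by have := variance_nonneg (fun g : ℂ => max (‖g‖ ^ 2 - i * (δ / 2)) 0)
                    stdComplexGaussian; positivity]
  exact Finset.sum_le_sum fun i _ => measure_excess_le (by positivity) (by positivity) hA

/-! ### Entropy bounds for the number of assignments. -/

theorem choose_le_exp_binEntropy {n m : ℕ} (h : m ≤ n) :
    (n.choose m : ℝ) ≤ Real.exp (n * Real.binEntropy (m / n)) := by
  rcases h.eq_or_lt with rfl | hlt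
  · rcases Nat.eq_zero_or_pos m with rfl | hm
    · simp
    · have : (m : ℝ) ≠ 0 := by positivity
      simp [this]
  rcases Nat.eq_zero_or_pos m with rfl | hm
  · simp
  have hn : (0 : ℝ) < n := by exact_mod_cast hm.trans hlt
  have hm' : (0 : ℝ) < m := by exact_mod_cast hm
  have hlt' : (m : ℝ) < n := by exact_mod_cast hlt
  set p : ℝ := m / n with hp
  have hp0 : 0 < p := by positivity
  have hp1 : 0 < 1 - p := by rw [hp, sub_pos, div_lt_one hn]; exact hlt'
  -- One term of the binomial expansion of `(p + (1 - p)) ^ n = 1`, at `p = m / n`.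
  have h1 : p ^ m * (1 - p) ^ (n - m) * n.choose m ≤ 1 := by
    calc p ^ m * (1 - p) ^ (n - m) * n.choose m
        ≤ ∑ i ∈ Finset.range (n + 1), p ^ i * (1 - p) ^ (n - i) * n.choose i :=
          Finset.single_le_sum (f := fun i => p ^ i * (1 - p) ^ (n - i) * (n.choose i : ℝ))
            (fun i _ => by positivity) (Finset.mem_range.2 (by omega))
      _ = (p + (1 - p)) ^ n := (add_pow p (1 - p) n).symm
      _ = 1 := by simp
  have h2 : p ^ m * (1 - p) ^ (n - m) = Real.exp (-(n * Real.binEntropy p)) := by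
    have e1 : p ^ m = Real.exp (m * Real.log p) := by rw [Real.exp_nat_mul, Real.exp_log hp0]
    have e2 : (1 - p) ^ (n - m) = Real.exp ((n - m : ℕ) * Real.log (1 - p)) := by
      rw [Real.exp_nat_mul, Real.exp_log hp1]
    rw [e1, e2, ← Real.exp_add, Nat.cast_sub h]
    congr 1
    rw [Real.binEntropy, Real.log_inv, Real.log_inv]
    have h3 : n * p = m := by rw [hp]; field_simp
    linear_combination -(Real.log p) * h3 + Real.log (1 - p) * h3
  rw [h2, Real.exp_neg, inv_mul_le_iff₀ (Real.exp_pos _), mul_one] at h1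
  exact h1

/-- At `ν = (c + t) / Ka` and `θ = t / Ka` the three terms of `gammaExp` are exactly the exponents
of the three factors: `1 - ν + θ` is `1 - c / Ka`, and `1 - ν pa + θ pa` is `(K - c) / K`. -/
theorem choose_mul_choose_mul_pow_le {n k K Ka c t : ℕ} (hn : 0 < n) (hct : c + t ≤ Ka)
    (hKa : Ka ≤ K) (hKa0 : 0 < Ka) :
    ((Ka.choose c * (K - c).choose t * (2 ^ k) ^ t : ℕ) : ℝ)
      ≤ Real.exp (n * gammaExp k (K / n) (Ka / K) ((c + t : ℕ) / Ka) (t / Ka)) := by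
  have hn' : (0 : ℝ) < n := by exact_mod_cast hn
  have hKa' : (0 : ℝ) < Ka := by exact_mod_cast hKa0
  have hK' : (0 : ℝ) < K := by exact_mod_cast hKa0.trans_le hKa
  have h1 := choose_le_exp_binEntropy (show c ≤ Ka by omega)
  have h2 := choose_le_exp_binEntropy (show t ≤ K - c by omega)
  have h3 : ((2 : ℝ) ^ k) ^ t = Real.exp (t * Real.log (2 ^ k)) := by
    rw [Real.exp_nat_mul, Real.exp_log (by positivity)]
  have hg : n * gammaExp k (K / n) (Ka / K) ((c + t : ℕ) / Ka) (t / Ka)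
      = Ka * Real.binEntropy (c / Ka) + (K - c : ℕ) * Real.binEntropy (t / (K - c : ℕ))
        + t * Real.log (2 ^ k) := by
    have e1 : 1 - ((c + t : ℕ) : ℝ) / Ka + t / Ka = 1 - c / Ka := by push_cast; ring
    have e2 : (t : ℝ) / Ka * (Ka / K) / (1 + t / Ka * (Ka / K) - (c + t : ℕ) / Ka * (Ka / K))
        = t / (K - c : ℕ) := by
      rw [Nat.cast_sub (by omega)]
      have : 1 + (t : ℝ) / Ka * (Ka / K) - (c + t : ℕ) / Ka * (Ka / K) = (K - c) / K := by
        push_cast; field_simp; ring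
      rw [this]
      field_simp
    have e3 : (K : ℝ) / n * (1 - (c + t : ℕ) / Ka * (Ka / K) + t / Ka * (Ka / K))
        = (K - c : ℕ) / n := by
      rw [Nat.cast_sub (by omega)]
      push_cast; field_simp; ring
    rw [gammaExp, e1, e2, e3, Real.binEntropy_one_sub]
    field_simp
  rw [hg, Real.exp_add, Real.exp_add, ← h3]
  push_cast
  gcongr

/-! ### Gaussian codebooks: power and pairwise comparison. -/

theorem lintegral_pi_prod {n : ℕ} {X : Type*} [MeasurableSpace X] (μ : Measure X)
    [IsProbabilityMeasure μ] {f : Fin n → X → ℝ≥0∞} (hf : ∀ i, Measurable (f i)) :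
    ∫⁻ x : Fin n → X, ∏ i, f i (x i) ∂(Measure.pi fun _ => μ) = ∏ i, ∫⁻ y, f i y ∂μ := by
  have hind : iIndepFun (fun (i : Fin n) (x : Fin n → X) => f i (x i))
      (Measure.pi fun _ => μ) := iIndepFun_pi fun i => (hf i).aemeasurable
  rw [lintegral_prod_eq_prod_lintegral_of_indepFun _ _ hind
    fun i => (hf i).comp (measurable_pi_apply i)]
  refine Finset.prod_congr rfl fun i _ => ?_
  exact (measurePreserving_eval (fun _ : Fin n => μ) i).lintegral_comp (hf i)

/-- The law of `n` independent families of i.i.d. `CN(0,1)` variables indexed by `ι`. -/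
def gaussianEnsemble (n : ℕ) (ι : Type*) [Fintype ι] : Measure (Fin n → ι → ℂ) :=
  Measure.pi fun _ => Measure.pi fun _ => stdComplexGaussian

section Ensemble

variable {ι : Type*} [Fintype ι]

instance (n : ℕ) : IsProbabilityMeasure (gaussianEnsemble n ι) := by
  unfold gaussianEnsemble; infer_instance

/-- Chernoff's bound for each codeword, then a union bound over the codewords. -/
theorem gaussianEnsemble_power_le {n : ℕ} {r : ℝ} (hr : 1 < r) :
    gaussianEnsemble n ι {G | ∃ l, n * r < ∑ i, ‖G i l‖ ^ 2}
      ≤ Fintype.card ι * ENNReal.ofReal ((r * Real.exp (1 - r)) ^ n) := by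
  have hr0 : 0 < r := by linarith
  -- The optimal exponent: `exp (x ‖g‖ ^ 2)` has mean `1 / (1 - x) = r`.
  set x := 1 - r⁻¹ with hx
  have hx0 : 0 < x := by rw [hx, sub_pos]; exact inv_lt_one_of_one_lt₀ hr
  have hxr : x * r = r - 1 := by rw [hx]; field_simp
  have key : ∀ l : ι, gaussianEnsemble n ι {G | n * r < ∑ i, ‖G i l‖ ^ 2}
      ≤ ENNReal.ofReal ((r * Real.exp (1 - r)) ^ n) := by
    intro l
    set f : (ι → ℂ) → ℝ≥0∞ := fun g =>
      ENNReal.ofReal (Real.exp (1 - r)) * ENNReal.ofReal (Real.exp (-(-x) * ‖0 + g l‖ ^ 2)) with hf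
    have hfm : Measurable f := by rw [hf]; fun_prop
    have hfi : ∫⁻ g, f g ∂(Measure.pi fun _ => stdComplexGaussian)
        = ENNReal.ofReal (r * Real.exp (1 - r)) := by
      rw [hf, lintegral_const_mul' _ _ ENNReal.ofReal_ne_top]
      have e := (measurePreserving_eval (fun _ : ι => stdComplexGaussian) l).lintegral_comp
        (f := fun g => ENNReal.ofReal (Real.exp (-(-x) * ‖0 + g‖ ^ 2))) (by fun_prop)
      rw [show ∫⁻ g : ι → ℂ, ENNReal.ofReal (Real.exp (-(-x) * ‖0 + g l‖ ^ 2))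
          ∂(Measure.pi fun _ => stdComplexGaussian) = _ from e, lintegral_exp_neg_mul_norm_add_sq (by rw [hx]; simp [hr0]),
        ← ENNReal.ofReal_mul (Real.exp_nonneg _)]
      congr 1
      rw [hx]
      simp [mul_comm]
    have hms : MeasurableSet {G : Fin n → ι → ℂ | n * r < ∑ i, ‖G i l‖ ^ 2} :=
      measurableSet_lt measurable_const (by fun_prop)
    calc gaussianEnsemble n ι {G | n * r < ∑ i, ‖G i l‖ ^ 2}
        = ∫⁻ G, {G : Fin n → ι → ℂ | n * r < ∑ i, ‖G i l‖ ^ 2}.indicator 1 G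
            ∂gaussianEnsemble n ι := (lintegral_indicator_one hms).symm
      _ ≤ ∫⁻ G, ∏ i, f (G i) ∂gaussianEnsemble n ι := by
        refine lintegral_mono fun G => Set.indicator_apply_le' (fun hG => ?_) fun _ => zero_le
        rw [Set.mem_ofPred_eq] at hG
        have e : ∀ i, f (G i) = ENNReal.ofReal (Real.exp (x * ‖G i l‖ ^ 2 - x * r)) := by
          intro i
          simp only [hf]
          rw [← ENNReal.ofReal_mul (Real.exp_nonneg _), ← Real.exp_add, hxr, zero_add]
          congr 2
          ring
        simp_rw [e]
        rw [← ENNReal.ofReal_prod_of_nonneg fun _ _ => Real.exp_nonneg _, ← Real.exp_sum,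
          Pi.one_apply, ← ENNReal.ofReal_one]
        refine ENNReal.ofReal_le_ofReal (Real.one_le_exp ?_)
        rw [Finset.sum_sub_distrib, ← Finset.mul_sum, Finset.sum_const, Finset.card_univ,
          Fintype.card_fin, nsmul_eq_mul]
        nlinarith
      _ = ENNReal.ofReal ((r * Real.exp (1 - r)) ^ n) := by
        rw [gaussianEnsemble, lintegral_pi_prod _ fun _ => hfm]
        simp_rw [hfi]
        rw [Finset.prod_const, Finset.card_univ, Fintype.card_fin,
          ENNReal.ofReal_pow (by positivity)]
  have hsub : {G : Fin n → ι → ℂ | ∃ l, n * r < ∑ i, ‖G i l‖ ^ 2}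
      = ⋃ l ∈ (Finset.univ : Finset ι), {G | n * r < ∑ i, ‖G i l‖ ^ 2} := by
    ext G; simp
  rw [hsub]
  refine (measure_biUnion_finset_le _ _).trans ((Finset.sum_le_sum fun l _ => key l).trans ?_)
  rw [Finset.sum_const, nsmul_eq_mul, Finset.card_univ]

variable [DecidableEq ι]

/-- The probability that the set `Γ` of codewords is at least as likely as `Γ₁` when `Γ₀` is sent;
`b` are the amplitudes. -/
theorem lintegral_pairwise_le {n : ℕ} (b : ι → ℂ) {Γ₀ Γ₁ Γ : Finset ι} (h₁ : Γ₁ ⊆ Γ₀)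
    (h₂ : Γ ∩ Γ₀ ⊆ Γ₁) {q : ℝ} (hq : 0 ≤ q)
    (hb : 4 * q * (1 + ∑ l ∈ Γ₀ \ Γ₁, ‖b l‖ ^ 2) ≤ ∑ l ∈ Γ₁ \ Γ, ‖b l‖ ^ 2) :
    ∫⁻ z, ∫⁻ G, {G : Fin n → ι → ℂ |
        ∑ i, ‖z i + ∑ l ∈ Γ₀, b l * G i l - ∑ l ∈ Γ, b l * G i l‖ ^ 2
          ≤ ∑ i, ‖z i + ∑ l ∈ Γ₀, b l * G i l - ∑ l ∈ Γ₁, b l * G i l‖ ^ 2}.indicator 1 G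
        ∂gaussianEnsemble n ι ∂stdComplexGaussianVec n
      ≤ ENNReal.ofReal ((1 + q)⁻¹ ^ n) := by
  -- Codewords of `Γ \ Γ₁` enter the residual with the opposite sign; absorbing the sign in the
  -- amplitude makes the change of residual one sum over the symmetric difference `T`. By `h₂` it
  -- involves none of the interfering codewords `R`.
  set a : ι → ℂ := fun l => if l ∈ Γ \ Γ₁ then -b l else b l with ha
  have hna : ∀ l, ‖a l‖ ^ 2 = ‖b l‖ ^ 2 := by
    intro l; simp only [ha]; split_ifs <;> simp
  set R := Γ₀ \ Γ₁ with hR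
  set T := Γ₁ \ Γ ∪ Γ \ Γ₁ with hT
  have hTR : Disjoint T R := by
    rw [Finset.disjoint_left]
    intro l hl hl'
    have hl' := Finset.mem_sdiff.1 hl'
    rcases Finset.mem_union.1 hl with hl | hl
    · exact hl'.2 (Finset.mem_sdiff.1 hl).1
    · exact hl'.2 (h₂ (Finset.mem_inter.2 ⟨(Finset.mem_sdiff.1 hl).1, hl'.1⟩))
  have hres₁ : ∀ g : ι → ℂ, ∑ l ∈ Γ₀, b l * g l - ∑ l ∈ Γ₁, b l * g l = ∑ l ∈ R, a l * g l := by
    intro g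
    rw [← Finset.sum_sdiff h₁, add_sub_cancel_right]
    refine Finset.sum_congr rfl fun l hl => ?_
    have : l ∉ Γ \ Γ₁ := fun h => Finset.disjoint_left.1 hTR (Finset.mem_union_right _ h) hl
    simp only [ha, this, if_false]
  have hres : ∀ g : ι → ℂ, ∑ l ∈ Γ₁, b l * g l - ∑ l ∈ Γ, b l * g l = ∑ l ∈ T, a l * g l := by
    intro g
    rw [hT, Finset.sum_union (Finset.disjoint_left.2 fun l hl hl' =>
      (Finset.mem_sdiff.1 hl').2 (Finset.mem_sdiff.1 hl).1),
      ← Finset.sum_inter_add_sum_sdiff Γ₁ Γ, ← Finset.sum_inter_add_sum_sdiff Γ Γ₁,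
      Finset.inter_comm Γ Γ₁, add_sub_add_left_eq_sub, sub_eq_add_neg, ← Finset.sum_neg_distrib]
    congr 1
    · refine Finset.sum_congr rfl fun l hl => ?_
      have : l ∉ Γ \ Γ₁ := fun h => (Finset.mem_sdiff.1 h).2 (Finset.mem_sdiff.1 hl).1
      simp only [ha, this, if_false]
    · refine Finset.sum_congr rfl fun l hl => ?_
      simp only [ha, hl, if_true, neg_mul]
  set B := 1 + ∑ l ∈ R, ‖a l‖ ^ 2 with hB
  set σ := ∑ l ∈ T, ‖a l‖ ^ 2 with hσ
  have hB0 : 0 < B := by positivity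
  have hσ0 : 0 ≤ σ := by positivity
  have hqσ : 4 * q * B ≤ σ := by
    rw [hB, hσ]
    simp_rw [hna]
    exact hb.trans (Finset.sum_le_sum_of_subset_of_nonneg Finset.subset_union_left
      fun _ _ _ => by positivity)
  -- The maximizer of `1 + lam σ - lam ^ 2 σ B`, whose maximum is `1 + σ / (4 B)`; this is the
  -- origin of the factor 4.
  set lam := 1 / (2 * B) with hlam
  have hlam0 : 0 < lam := by positivity
  have hval : 1 + lam * σ - lam ^ 2 * σ * (‖(1 : ℂ)‖ ^ 2 + ∑ l ∈ R, ‖a l‖ ^ 2)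
      = 1 + σ / (4 * B) := by
    rw [norm_one, one_pow, ← hB, hlam]; field_simp; ring
  set f : ℂ → (ι → ℂ) → ℝ≥0∞ := fun z g => ENNReal.ofReal (Real.exp (-lam * ‖1 * z
    + ∑ j ∈ R, a j * g j + ∑ j ∈ T, a j * g j‖ ^ 2
    + lam * ‖1 * z + ∑ j ∈ R, a j * g j‖ ^ 2)) with hf
  have hfm : Measurable (Function.uncurry f) := by
    simp only [hf, Function.uncurry_def]; fun_prop
  have hfi : ∫⁻ z, ∫⁻ g, f z g ∂(Measure.pi fun _ => stdComplexGaussian) ∂stdComplexGaussian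
      ≤ ENNReal.ofReal (1 + q)⁻¹ := by
    simp only [hf]
    rw [lintegral_exp_norm_sub_norm a hTR 1 hlam0 (by rw [hval]; positivity), hval]
    refine ENNReal.ofReal_le_ofReal (inv_anti₀ (by positivity) ?_)
    have : q ≤ σ / (4 * B) := by rw [le_div_iff₀ (by positivity)]; linarith
    linarith
  calc _ ≤ ∫⁻ z, ∫⁻ G, ∏ i, f (z i) (G i) ∂gaussianEnsemble n ι ∂stdComplexGaussianVec n := by
        refine lintegral_mono fun z => lintegral_mono fun G => ?_
        refine Set.indicator_apply_le' (fun hG => ?_) fun _ => zero_le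
        rw [Set.mem_ofPred_eq] at hG
        have e₁ : ∀ i, z i + ∑ l ∈ Γ₀, b l * G i l - ∑ l ∈ Γ₁, b l * G i l
            = 1 * z i + ∑ l ∈ R, a l * G i l := by
          intro i; rw [← hres₁]; ring
        have e : ∀ i, z i + ∑ l ∈ Γ₀, b l * G i l - ∑ l ∈ Γ, b l * G i l
            = 1 * z i + ∑ l ∈ R, a l * G i l + ∑ l ∈ T, a l * G i l := by
          intro i; rw [← hres₁, ← hres]; ring
        simp_rw [e₁, e] at hG
        rw [← ENNReal.ofReal_prod_of_nonneg fun _ _ => Real.exp_nonneg _, ← Real.exp_sum,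
          Pi.one_apply, ← ENNReal.ofReal_one]
        refine ENNReal.ofReal_le_ofReal (Real.one_le_exp ?_)
        rw [Finset.sum_add_distrib, ← Finset.mul_sum, ← Finset.mul_sum]
        nlinarith
    _ = ∏ _i : Fin n, ∫⁻ z, ∫⁻ g, f z g ∂(Measure.pi fun _ => stdComplexGaussian)
          ∂stdComplexGaussian := by
        have : ∀ z : Fin n → ℂ, ∫⁻ G, ∏ i, f (z i) (G i) ∂gaussianEnsemble n ι
            = ∏ i, ∫⁻ g, f (z i) g ∂(Measure.pi fun _ => stdComplexGaussian) := fun z =>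
          lintegral_pi_prod _ fun i => hfm.of_uncurry_left
        simp_rw [this]
        exact lintegral_pi_prod _ fun i => hfm.lintegral_prod_right'
    _ ≤ _ := by
        rw [Finset.prod_const, Finset.card_univ, Fintype.card_fin,
          ENNReal.ofReal_pow (by positivity)]
        gcongr

end Ensemble

/-! ### Minimizing selections and partial assignments of messages. -/

theorem exists_measurable_argmin {Ω ι : Type*} [MeasurableSpace Ω] [Fintype ι] [Nonempty ι]
    (f : ι → Ω → ℝ) (hf : ∀ i, Measurable (f i)) :
    ∃ g : Ω → ι, Measurable[_, ⊤] g ∧ ∀ x i, f (g x) x ≤ f i x := by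
  classical
  let _ : MeasurableSpace ι := ⊤
  have key : ∀ s : Finset ι, s.Nonempty → ∃ g : Ω → ι, Measurable g ∧
      Measurable (fun x => f (g x) x) ∧ ∀ x, ∀ i ∈ s, f (g x) x ≤ f i x := by
    intro s hs
    induction hs using Finset.Nonempty.cons_induction with
    | singleton i => exact ⟨fun _ => i, measurable_const, hf i, by simp⟩
    | cons i s hi hs ih =>
      obtain ⟨g, hg, hv, hmin⟩ := ih
      have hset := measurableSet_le (hf i) hv
      -- The induction also carries the measurability of the minimal value, so that the set on which
      -- the new index wins is measurable.
      refine ⟨fun x => if f i x ≤ f (g x) x then i else g x, Measurable.ite hset measurable_const hg,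
        ?_, fun x l hl => ?_⟩
      · have : (fun x => f (if f i x ≤ f (g x) x then i else g x) x)
            = fun x => min (f i x) (f (g x) x) := by
          funext x
          split_ifs with h
          · rw [min_eq_left h]
          · rw [min_eq_right (not_le.1 h).le]
        rw [this]
        exact (hf i).min hv
      · rcases Finset.mem_cons.1 hl with rfl | hl
        · dsimp only
          split_ifs with h
          · exact le_rfl
          · exact (not_le.1 h).le
        · dsimp only
          split_ifs with h
          · exact h.trans (hmin x l hl)
          · exact hmin x l hl
  obtain ⟨g, hg, -, hmin⟩ := key Finset.univ Finset.univ_nonempty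
  exact ⟨g, hg, fun x i => hmin x i (Finset.mem_univ i)⟩

section Assignments

variable {k K : ℕ}

/-- The partial assignment of messages to users that agrees with `W` on `S`. -/
def restrictMessages (S : Finset (Fin K)) (W : Fin K → Fin (2 ^ k)) (j : Fin K) :
    Option (Fin (2 ^ k)) :=
  if j ∈ S then some (W j) else none

theorem card_isSome_restrictMessages (S : Finset (Fin K)) (W : Fin K → Fin (2 ^ k)) :
    (Finset.univ.filter fun j => (restrictMessages S W j).isSome = true).card = S.card := by
  congr 1
  ext j
  by_cases hj : j ∈ S <;> simp [restrictMessages, hj]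

/-- The codewords selected by a partial assignment of messages to users. -/
def graph (w : Fin K → Option (Fin (2 ^ k))) : Finset (Fin K × Fin (2 ^ k)) :=
  Finset.univ.filter fun l => w l.1 = some l.2

theorem mem_graph {w : Fin K → Option (Fin (2 ^ k))} {l : Fin K × Fin (2 ^ k)} :
    l ∈ graph w ↔ w l.1 = some l.2 := by
  simp [graph]

theorem mem_graph_restrictMessages {S : Finset (Fin K)} {W : Fin K → Fin (2 ^ k)}
    {l : Fin K × Fin (2 ^ k)} : l ∈ graph (restrictMessages S W) ↔ l.1 ∈ S ∧ W l.1 = l.2 := by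
  rw [mem_graph, restrictMessages]
  split_ifs with h <;> simp [h]

theorem graph_restrictMessages (S : Finset (Fin K)) (W : Fin K → Fin (2 ^ k)) :
    graph (restrictMessages S W) = S.image fun j => (j, W j) := by
  ext ⟨j, m⟩
  rw [mem_graph_restrictMessages]
  simp only [Finset.mem_image, Prod.mk.injEq]
  constructor
  · rintro ⟨h1, h2⟩
    exact ⟨j, h1, rfl, h2⟩
  · rintro ⟨j', h1, rfl, h2⟩
    exact ⟨h1, h2⟩

theorem sum_graph_restrictMessages {E : Type*} [AddCommMonoid E] (S : Finset (Fin K))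
    (W : Fin K → Fin (2 ^ k)) (f : Fin K × Fin (2 ^ k) → E) :
    ∑ l ∈ graph (restrictMessages S W), f l = ∑ j ∈ S, f (j, W j) := by
  rw [graph_restrictMessages, Finset.sum_image]
  intro a _ b _ hab
  exact (Prod.mk.inj hab).1

/-- The active users to which the assignment `w` gives the right message. -/
def correctSet (A : Finset (Fin K)) (W : Fin K → Fin (2 ^ k))
    (w : Fin K → Option (Fin (2 ^ k))) : Finset (Fin K) :=
  A.filter fun j => w j = some (W j)

variable {N Ka : ℕ} {A : Finset (Fin K)} {W : Fin K → Fin (2 ^ k)}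

theorem correctSet_subset (w : Fin K → Option (Fin (2 ^ k))) : correctSet A W w ⊆ A :=
  Finset.filter_subset _ _

theorem correctSet_subset_isSome (w : Fin K → Option (Fin (2 ^ k))) :
    correctSet A W w ⊆ Finset.univ.filter fun j => (w j).isSome = true := by
  intro j hj
  have := (Finset.mem_filter.1 hj).2
  simp [this]

theorem card_correctSet_le (w : DecoderOutput k K N) : (correctSet A W w.1).card ≤ N :=
  (Finset.card_le_card (correctSet_subset_isSome w.1)).trans_eq w.2

/-- An output is determined by the correct set `C`, the set `F` of the other declared users and the
messages on `F`. These give the three factors; users of `F` may be active with a wrong message or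
inactive, so `F` ranges over subsets of the complement of `C`. -/
theorem card_decoderOutput_correctSet_le {c t : ℕ} (hN : c + t = N) :
    (Finset.univ.filter fun w : DecoderOutput k K N => (correctSet A W w.1).card = c).card
      ≤ A.card.choose c * (K - c).choose t * (2 ^ k) ^ t := by
  classical
  set supp : DecoderOutput k K N → Finset (Fin K) := fun w =>
    Finset.univ.filter fun j => (w.1 j).isSome = true with hsupp
  have hcover : (Finset.univ.filter fun w : DecoderOutput k K N => (correctSet A W w.1).card = c)
      ⊆ (Finset.powersetCard c A).biUnion fun C =>
        (Finset.powersetCard t Cᶜ).biUnion fun F =>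
          Finset.univ.filter fun w => correctSet A W w.1 = C ∧ supp w \ C = F := by
    intro w hw
    have hw := (Finset.mem_filter.1 hw).2
    have hcs : correctSet A W w.1 ⊆ supp w := correctSet_subset_isSome w.1
    simp only [Finset.mem_biUnion, Finset.mem_powersetCard, Finset.mem_filter, Finset.mem_univ,
      true_and]
    refine ⟨correctSet A W w.1, ⟨correctSet_subset w.1, hw⟩, supp w \ correctSet A W w.1,
      ⟨?_, ?_⟩, rfl, rfl⟩
    · intro j hj
      exact Finset.mem_compl.2 (Finset.mem_sdiff.1 hj).2
    · rw [Finset.card_sdiff_of_subset hcs, hw]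
      have : (supp w).card = N := w.2
      omega
  have hfib : ∀ C F : Finset (Fin K), (Finset.univ.filter fun w : DecoderOutput k K N =>
      correctSet A W w.1 = C ∧ supp w \ C = F).card ≤ (2 ^ k) ^ F.card := by
    intro C F
    have : ((2 : ℕ) ^ k) ^ F.card = (Finset.univ : Finset (F → Fin (2 ^ k))).card := by
      simp
    rw [this]
    -- The default `0` is never used for outputs in the fibre: they declare every user of `F`.
    refine Finset.card_le_card_of_injOn (fun w j => (w.1 j.1).getD 0) (fun _ _ => by simp) ?_
    intro w hw w' hw' heq
    have hw := (Finset.mem_filter.1 hw).2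
    have hw' := (Finset.mem_filter.1 hw').2
    apply Subtype.ext
    funext j
    by_cases hC : j ∈ C
    · have h1 : j ∈ correctSet A W w.1 := hw.1 ▸ hC
      have h2 : j ∈ correctSet A W w'.1 := hw'.1 ▸ hC
      rw [(Finset.mem_filter.1 h1).2, (Finset.mem_filter.1 h2).2]
    · by_cases hF : j ∈ F
      · have h1 : j ∈ supp w \ C := hw.2 ▸ hF
        have h2 : j ∈ supp w' \ C := hw'.2 ▸ hF
        have h1' := (Finset.mem_filter.1 (Finset.mem_sdiff.1 h1).1).2
        have h2' := (Finset.mem_filter.1 (Finset.mem_sdiff.1 h2).1).2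
        obtain ⟨a, ha⟩ := Option.isSome_iff_exists.1 h1'
        obtain ⟨b, hb⟩ := Option.isSome_iff_exists.1 h2'
        have := congrFun heq ⟨j, hF⟩
        simp only [ha, hb, Option.getD_some] at this
        rw [ha, hb, this]
      · have h1 : j ∉ supp w := fun h => hF (hw.2 ▸ Finset.mem_sdiff.2 ⟨h, hC⟩)
        have h2 : j ∉ supp w' := fun h => hF (hw'.2 ▸ Finset.mem_sdiff.2 ⟨h, hC⟩)
        simp only [hsupp, Finset.mem_filter, Finset.mem_univ, true_and, Option.not_isSome_iff_eq_none]
          at h1 h2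
        rw [h1, h2]
  refine (Finset.card_le_card hcover).trans ?_
  refine (Finset.card_biUnion_le_card_mul _ _ ((K - c).choose t * (2 ^ k) ^ t) fun C hC => ?_).trans
    (by rw [Finset.card_powersetCard, mul_assoc])
  have hC := (Finset.mem_powersetCard.1 hC).2
  refine (Finset.card_biUnion_le_card_mul _ _ ((2 ^ k) ^ t) fun F hF => ?_).trans
    (by rw [Finset.card_powersetCard, Finset.card_compl, Fintype.card_fin, hC])
  have hF := (Finset.mem_powersetCard.1 hF).2
  exact hF ▸ hfib C F

theorem nonempty_decoderOutput (hN : N ≤ K) : Nonempty (DecoderOutput k K N) := by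
  obtain ⟨S, -, hS⟩ := Finset.exists_subset_card_eq
    (s := (Finset.univ : Finset (Fin K))) (n := N) (by simpa using hN)
  exact ⟨restrictMessages S fun _ => 0, by rw [card_isSome_restrictMessages, hS]⟩

theorem exists_extension (hN : N ≤ Ka) (hKa : Ka ≤ K) (w : DecoderOutput k K N) :
    ∃ w' : DecoderOutput k K Ka, ∀ j, (w.1 j).isSome = true → w'.1 j = w.1 j := by
  obtain ⟨S, hS, -, hcard⟩ := Finset.exists_subsuperset_card_eq
    (Finset.subset_univ (Finset.univ.filter fun j => (w.1 j).isSome = true)) (n := Ka)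
    (by rw [w.2]; exact hN) (by simpa using hKa)
  refine ⟨⟨fun j => if (w.1 j).isSome = true then w.1 j else restrictMessages S (fun _ => 0) j,
    ?_⟩, fun j hj => if_pos hj⟩
  rw [← hcard]
  congr 1
  ext j
  by_cases h : (w.1 j).isSome = true
  · have : j ∈ S := hS (by simp [h])
    simp [h, this]
  · by_cases hj : j ∈ S <;> simp [h, hj, restrictMessages]

/-- Extending an assignment keeps its correct decisions, so the arbitrary additional guesses can
only help. -/
theorem errorFraction_le_of_extension (hA : A.card = Ka) {w : DecoderOutput k K N}
    {w' : DecoderOutput k K Ka} (h : ∀ j, (w.1 j).isSome = true → w'.1 j = w.1 j) :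
    Scheme.errorFraction A W w' ≤ ((Ka - (correctSet A W w.1).card : ℕ) : ℝ≥0∞) / Ka := by
  unfold Scheme.errorFraction
  gcongr
  have hcard : (A \ correctSet A W w.1).card = Ka - (correctSet A W w.1).card := by
    rw [Finset.card_sdiff_of_subset (correctSet_subset w.1), hA]
  refine (Finset.card_le_card fun j hj => ?_).trans_eq hcard
  rw [Finset.mem_filter] at hj
  refine Finset.mem_sdiff.2 ⟨hj.1, fun hc => hj.2 ?_⟩
  have hc := (Finset.mem_filter.1 hc).2
  rw [h j (by simp [hc]), hc]

theorem errorFraction_le_one (hA : A.card = Ka) (w : DecoderOutput k K Ka) :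
    Scheme.errorFraction A W w ≤ 1 := by
  unfold Scheme.errorFraction
  refine ENNReal.div_le_of_le_mul ?_
  rw [one_mul]
  exact_mod_cast hA ▸ Finset.card_filter_le _ _

end Assignments

/-! ### Averaging the error probability over codes. -/

namespace Scheme

variable {n k K Ka : ℕ}

theorem pupe_eq_of_encoder_pure (C : Scheme n k K Ka)
    (hC : ∀ j m, C.encoder j m = PMF.pure m) :
    C.pupe = (∑ A ∈ Finset.powersetCard Ka (Finset.univ : Finset (Fin K)),
      (∑ W : Fin K → Fin (2 ^ k), C.condError A W W) / ((2 : ℝ≥0∞) ^ k) ^ K)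
        / (K.choose Ka : ℝ≥0∞) := by
  classical
  unfold pupe
  congr 1
  refine Finset.sum_congr rfl fun A _ => ?_
  congr 1
  refine Finset.sum_congr rfl fun W _ => ?_
  rw [Finset.sum_eq_single W]
  · simp [hC]
  · intro x _ hx
    obtain ⟨j, hj⟩ := Function.ne_iff.1 hx
    rw [Finset.prod_eq_zero (Finset.mem_univ j), zero_mul]
    rw [hC, PMF.pure_apply, if_neg hj]
  · simp

/-- The mean error probability is an average over active sets and messages, so a bound uniform in
both suffices. -/
theorem lintegral_pupe_le {Ω : Type*} [MeasurableSpace Ω] {P : Measure Ω}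
    (hKa : Ka ≤ K) (C : Ω → Scheme n k K Ka) (hC : ∀ ω j m, (C ω).encoder j m = PMF.pure m)
    (hm : ∀ A W, Measurable fun ω => (C ω).condError A W W) {β : ℝ≥0∞}
    (hβ : ∀ A W, A.card = Ka → ∫⁻ ω, (C ω).condError A W W ∂P ≤ β) :
    ∫⁻ ω, (C ω).pupe ∂P ≤ β := by
  simp_rw [fun ω => pupe_eq_of_encoder_pure (C ω) (hC ω), div_eq_mul_inv]
  have hM0 : ((2 : ℝ≥0∞) ^ k) ^ K ≠ 0 := by simp
  have hMt : ((2 : ℝ≥0∞) ^ k) ^ K ≠ ∞ := by simp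
  have hch0 : (K.choose Ka : ℝ≥0∞) ≠ 0 := by
    exact_mod_cast (Nat.choose_pos hKa).ne'
  rw [lintegral_mul_const' _ _ (ENNReal.inv_ne_top.2 hch0), lintegral_finsetSum _
    fun A _ => (Finset.measurable_fun_sum _ fun W _ => hm A W).mul_const _]
  have h1 : ∀ A ∈ Finset.powersetCard Ka (Finset.univ : Finset (Fin K)),
      ∫⁻ ω, (∑ W : Fin K → Fin (2 ^ k), (C ω).condError A W W) * (((2 : ℝ≥0∞) ^ k) ^ K)⁻¹ ∂P
        ≤ β := by
    intro A hA
    rw [lintegral_mul_const' _ _ (ENNReal.inv_ne_top.2 hM0), lintegral_finsetSum _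
      fun W _ => hm A W, ← div_eq_mul_inv]
    refine ENNReal.div_le_of_le_mul ?_
    refine (Finset.sum_le_sum fun W _ => hβ A W (Finset.mem_powersetCard.1 hA).2).trans ?_
    rw [Finset.sum_const, nsmul_eq_mul, Finset.card_univ, mul_comm]
    simp
  rw [← div_eq_mul_inv]
  refine ENNReal.div_le_of_le_mul ((Finset.sum_le_sum h1).trans ?_)
  rw [Finset.sum_const, nsmul_eq_mul, Finset.card_powersetCard, Finset.card_univ,
    Fintype.card_fin, mul_comm]

theorem condError_le_one (C : Scheme n k K Ka) {A : Finset (Fin K)} (hA : A.card = Ka)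
    (W x : Fin K → Fin (2 ^ k)) : C.condError A W x ≤ 1 := by
  have h1 : ∀ p, ∑ w, C.decoder p w * errorFraction A W w ≤ 1 := by
    intro p
    calc ∑ w, C.decoder p w * errorFraction A W w ≤ ∑ w, C.decoder p w :=
          Finset.sum_le_sum fun w _ => mul_le_of_le_one_right' (errorFraction_le_one hA w)
      _ = 1 := by rw [← (C.decoder p).tsum_coe, tsum_fintype]
  calc C.condError A W x ≤ ∫⁻ _h, ∫⁻ _z, 1 ∂(stdComplexGaussianVec n)
        ∂(stdComplexGaussianVec K) := lintegral_mono fun h => lintegral_mono fun z => h1 _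
    _ = 1 := by simp

end Scheme

/-- Zero codewords and a constant decoder. This settles `ϵ = 1` and provides codes at the
blocklengths where the asymptotic argument does not yet apply. -/
theorem existsCode_one {n k K Ka : ℕ} (hKa : Ka ≤ K) (e : ℝ≥0) : ExistsCode n k 1 e K Ka := by
  obtain ⟨w⟩ := nonempty_decoderOutput (k := k) hKa
  let C : Scheme n k K Ka :=
    { codebook := fun _ _ _ => 0
      encoder := fun _ m => PMF.pure m
      decoder := fun _ => PMF.pure w
      measurable_decoder := fun _ => measurable_const }
  refine ⟨C, fun j m => ?_, ?_⟩
  · simp only [C, norm_zero, ne_eq, OfNat.ofNat_ne_zero, not_false_eq_true, zero_pow,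
      Finset.sum_const_zero]
    positivity
  · have := Scheme.lintegral_pupe_le (P := Measure.dirac ()) hKa (fun _ => C)
      (fun _ _ _ => rfl) (fun _ _ => measurable_const) (β := 1) fun A W hA => by
        simpa using C.condError_le_one hA W W
    simpa using this

theorem measurable_lintegral_middle {X Y Z : Type*} [MeasurableSpace X] [MeasurableSpace Y]
    [MeasurableSpace Z] (ν : Measure Y) [SFinite ν] {f : X → Y → Z → ℝ≥0∞}
    (hf : Measurable fun p : X × Y × Z => f p.1 p.2.1 p.2.2) :
    Measurable fun q : Z × X => ∫⁻ y, f q.2 y q.1 ∂ν :=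
  Measurable.lintegral_prod_right' (f := fun q : (Z × X) × Y => f q.1.2 q.2 q.1.1)
    (hf.comp (f := fun q : (Z × X) × Y => (q.1.2, q.2, q.1.1)) (by fun_prop))

/-- Used to move the integral over the codebook inside those over fading and noise: the comparison
assignment depends on the fading, which must be fixed first. -/
theorem lintegral_rotate {X Y Z : Type*} [MeasurableSpace X] [MeasurableSpace Y]
    [MeasurableSpace Z] (μ : Measure X) (ν : Measure Y) (ρ : Measure Z) [SFinite μ] [SFinite ν]
    [SFinite ρ] {f : X → Y → Z → ℝ≥0∞} (hf : Measurable fun p : X × Y × Z => f p.1 p.2.1 p.2.2) :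
    ∫⁻ z, ∫⁻ x, ∫⁻ y, f x y z ∂ν ∂μ ∂ρ = ∫⁻ x, ∫⁻ y, ∫⁻ z, f x y z ∂ρ ∂ν ∂μ := by
  rw [lintegral_lintegral_swap (measurable_lintegral_middle ν hf).aemeasurable]
  refine lintegral_congr fun x => ?_
  exact lintegral_lintegral_swap (hf.comp (f := fun q : Z × Y => (x, q.2, q.1))
    (by fun_prop)).aemeasurable

/-! ### Minimum-distance decoding of the Gaussian codebook. -/

section MinimumDistance

variable {n k K Ka N : ℕ}

/-- The squared distance between the received signal and its reconstruction from the partial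
assignment `w`, when the codebook is `s • G`. -/
def codeMetric (s : ℝ) (w : Fin K → Option (Fin (2 ^ k)))
    (p : (Fin n → Fin K × Fin (2 ^ k) → ℂ) × (Fin n → ℂ) × (Fin K → ℂ)) : ℝ :=
  ∑ i, ‖p.2.1 i - ∑ l ∈ graph w, p.2.2 l.1 * s * p.1 i l‖ ^ 2

theorem measurable_codeMetric (s : ℝ) (w : Fin K → Option (Fin (2 ^ k))) :
    Measurable (codeMetric (n := n) s w) := by
  unfold codeMetric; fun_prop

/-- The observation of the receiver, as a function of the fading, the noise and the codebook. -/
def observation (s : ℝ) (A : Finset (Fin K)) (W : Fin K → Fin (2 ^ k)) (h : Fin K → ℂ)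
    (z : Fin n → ℂ) (G : Fin n → Fin K × Fin (2 ^ k) → ℂ) :
    (Fin n → Fin K × Fin (2 ^ k) → ℂ) × (Fin n → ℂ) × (Fin K → ℂ) :=
  (G, fun i => z i + ∑ l ∈ graph (restrictMessages A W), h l.1 * s * G i l, h)

theorem measurable_observation (s : ℝ) (A : Finset (Fin K)) (W : Fin K → Fin (2 ^ k)) :
    Measurable fun p : (Fin K → ℂ) × (Fin n → ℂ) × (Fin n → Fin K × Fin (2 ^ k) → ℂ) =>
      observation s A W p.1 p.2.1 p.2.2 := by
  unfold observation; fun_prop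

/-- The condition on the parameters under which the expected number of wrong assignments with `t`
errors that are preferred to the right one is exponentially small, for all `t` such that more than
a fraction `ϵ₁` of the active users is not decoded. -/
def SeparationCondition (n k K Ka N : ℕ) (P ϵ₁ η δ : ℝ) : Prop :=
  ∀ t m : ℕ, t ≤ m → m ≤ N → ϵ₁ * Ka < Ka - N + t →
    0 ≤ gammaExp k (K / n) (Ka / K) (N / Ka) (t / Ka) + η ∧
    4 * (Real.exp (gammaExp k (K / n) (Ka / K) (N / Ka) (t / Ka) + η) - 1)
        * (1 + P * (Ka * (xi (m / Ka) ((m + (Ka - N)) / Ka) + 2 * δ)))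
      ≤ P * (Ka * (xi ((m - t) / Ka) (m / Ka) - 2 * δ))

variable {s ϵ₁ η δ : ℝ} {A : Finset (Fin K)} {W : Fin K → Fin (2 ^ k)} {h : Fin K → ℂ}

/-- The competitor of `w` keeps its correct decisions `C` and adds the true messages of the `t`
strongest missed users `T`. Exactly `Ka - N` active users then remain as interference, and
`exists_split` with `S = A \ C` estimates both energies in the form that `SeparationCondition`
handles. -/
theorem exists_better_assignment (hN : N ≤ Ka) (hA : A.card = Ka) (hδ : 0 ≤ δ)
    (hϵ : (Ka : ℝ) - N ≤ ϵ₁ * Ka) (hsep : SeparationCondition n k K Ka N (s ^ 2) ϵ₁ η δ)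
    (hh : ExcessClose A (fun j => ‖h j‖ ^ 2) δ) (w : DecoderOutput k K N)
    (hw : ϵ₁ * Ka < Ka - (correctSet A W w.1).card) :
    ∃ w₁ : DecoderOutput k K N,
      ∫⁻ z, ∫⁻ G, {G : Fin n → Fin K × Fin (2 ^ k) → ℂ |
        codeMetric s w.1 (observation s A W h z G)
          ≤ codeMetric s w₁.1 (observation s A W h z G)}.indicator 1 G
        ∂gaussianEnsemble n (Fin K × Fin (2 ^ k)) ∂stdComplexGaussianVec n
      ≤ ENNReal.ofReal (Real.exp (-(n * (gammaExp k (K / n) (Ka / K) (N / Ka)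
          ((N - (correctSet A W w.1).card : ℕ) / Ka) + η)))) := by
  set C := correctSet A W w.1 with hC
  have hCA : C ⊆ A := correctSet_subset w.1
  have hCN : C.card ≤ N := card_correctSet_le w
  set t := N - C.card with ht
  have htr : (t : ℝ) = N - C.card := by rw [ht, Nat.cast_sub hCN]
  have ht0 : 0 < t := by
    have : (0 : ℝ) < t := by rw [htr]; linarith
    exact_mod_cast this
  have hS : (A \ C).card = Ka - C.card := by rw [Finset.card_sdiff_of_subset hCA, hA]
  obtain ⟨T, hTS, hT, m, htm, hmA, hlow, hup⟩ := hh.exists_split hδ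
    (fun j => by positivity) (Finset.sdiff_subset : A \ C ⊆ A) ht0 (by omega)
  have hTC : Disjoint C T := Finset.disjoint_left.2 fun j hj hj' =>
    (Finset.mem_sdiff.1 (hTS hj')).2 hj
  have hcard : (C ∪ T).card = N := by
    rw [Finset.card_union_of_disjoint hTC, hT]; omega
  have hCTA : C ∪ T ⊆ A := Finset.union_subset hCA (hTS.trans Finset.sdiff_subset)
  obtain ⟨hγ, hsepm⟩ := hsep t m htm (by omega) (by rw [htr]; linarith)
  set γ := gammaExp k (K / n) (Ka / K) (N / Ka) (t / Ka) with hγdef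
  have hsub : (((A \ C).card : ℝ) - t) = Ka - N := by
    rw [hS, Nat.cast_sub (by omega), htr]; ring
  rw [hsub, hA] at hup
  rw [hA] at hlow
  refine ⟨⟨restrictMessages (C ∪ T) W, by rw [card_isSome_restrictMessages, hcard]⟩, ?_⟩
  have hq : 0 ≤ Real.exp (γ + η) - 1 := by
    have := Real.one_le_exp hγ
    linarith
  set b : Fin K × Fin (2 ^ k) → ℂ := fun l => h l.1 * s with hb
  have hnb : ∀ l, ‖b l‖ ^ 2 = s ^ 2 * ‖h l.1‖ ^ 2 := by
    intro l
    simp only [hb, norm_mul, Complex.norm_real, mul_pow, Real.norm_eq_abs, sq_abs]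
    ring
  have h₁ : graph (restrictMessages (C ∪ T) W) ⊆ graph (restrictMessages A W) := by
    intro l hl
    rw [mem_graph_restrictMessages] at hl ⊢
    exact ⟨hCTA hl.1, hl.2⟩
  have h₂ : graph w.1 ∩ graph (restrictMessages A W) ⊆ graph (restrictMessages (C ∪ T) W) := by
    intro l hl
    obtain ⟨hl1, hl2⟩ := Finset.mem_inter.1 hl
    rw [mem_graph_restrictMessages] at hl2 ⊢
    rw [mem_graph] at hl1
    exact ⟨Finset.mem_union_left _ (Finset.mem_filter.2 ⟨hl2.1, by rw [hl1, hl2.2]⟩), hl2.2⟩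
  have e₁ : graph (restrictMessages A W) \ graph (restrictMessages (C ∪ T) W)
      = graph (restrictMessages ((A \ C) \ T) W) := by
    ext l
    simp only [Finset.mem_sdiff, mem_graph_restrictMessages, Finset.mem_union]
    tauto
  have e₂ : graph (restrictMessages T W) ⊆ graph (restrictMessages (C ∪ T) W) \ graph w.1 := by
    intro l hl
    rw [mem_graph_restrictMessages] at hl
    rw [Finset.mem_sdiff, mem_graph_restrictMessages, mem_graph]
    refine ⟨⟨Finset.mem_union_right _ hl.1, hl.2⟩, fun hwl => ?_⟩
    refine Finset.disjoint_left.1 hTC (Finset.mem_filter.2 ⟨hCTA (Finset.mem_union_right _ hl.1),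
      ?_⟩) hl.1
    rw [hwl, hl.2]
  have key := lintegral_pairwise_le (n := n) b h₁ h₂ hq ?_
  · have hpow : (1 + (Real.exp (γ + η) - 1))⁻¹ ^ n = Real.exp (-(n * (γ + η))) := by
      rw [add_sub_cancel, ← Real.exp_neg, ← Real.exp_nat_mul]
      congr 1; ring
    rw [hpow] at key
    exact key
  · rw [e₁, sum_graph_restrictMessages]
    refine le_trans ?_ (Finset.sum_le_sum_of_subset_of_nonneg e₂ fun _ _ _ => by positivity)
    rw [sum_graph_restrictMessages]
    simp_rw [hnb, ← Finset.mul_sum]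
    calc 4 * (Real.exp (γ + η) - 1) * (1 + s ^ 2 * ∑ j ∈ (A \ C) \ T, ‖h j‖ ^ 2)
        ≤ 4 * (Real.exp (γ + η) - 1)
          * (1 + s ^ 2 * (Ka * (xi (m / Ka) ((m + (Ka - N)) / Ka) + 2 * δ))) := by gcongr
      _ ≤ s ^ 2 * (Ka * (xi ((m - t) / Ka) (m / Ka) - 2 * δ)) := hsepm
      _ ≤ s ^ 2 * ∑ j ∈ T, ‖h j‖ ^ 2 := by gcongr

/-- Grouping the assignments by `t`, each of the `N + 1` groups has at most `exp (n γ)` members,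
which cancels `exp (-(n γ))`. -/
theorem sum_exp_gammaExp_le (hn : 0 < n) (hN : N ≤ Ka) (hKa : Ka ≤ K) (hKa0 : 0 < Ka)
    (hA : A.card = Ka) (B : Finset (DecoderOutput k K N)) :
    ∑ w ∈ B, ENNReal.ofReal (Real.exp (-(n * (gammaExp k (K / n) (Ka / K) (N / Ka)
        ((N - (correctSet A W w.1).card : ℕ) / Ka) + η))))
      ≤ ENNReal.ofReal ((N + 1) * Real.exp (-(n * η))) := by
  classical
  set g : ℕ → ℝ := fun t => gammaExp k (K / n) (Ka / K) (N / Ka) (t / Ka) with hg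
  set τ : DecoderOutput k K N → ℕ := fun w => N - (correctSet A W w.1).card with hτ
  calc ∑ w ∈ B, ENNReal.ofReal (Real.exp (-(n * (g (τ w) + η))))
      ≤ ∑ w, ENNReal.ofReal (Real.exp (-(n * (g (τ w) + η)))) :=
        Finset.sum_le_sum_of_subset (Finset.subset_univ B)
    _ = ∑ t ∈ Finset.range (N + 1), ∑ w with τ w = t,
          ENNReal.ofReal (Real.exp (-(n * (g (τ w) + η)))) :=
        (Finset.sum_fiberwise_of_maps_to (fun w _ => Finset.mem_range.2 (by
          simp only [hτ]; omega)) _).symm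
    _ ≤ ∑ t ∈ Finset.range (N + 1), ENNReal.ofReal (Real.exp (-(n * η))) := by
        refine Finset.sum_le_sum fun t ht => ?_
        have htN : t ≤ N := by have := Finset.mem_range.1 ht; omega
        have hfib : (Finset.univ.filter fun w : DecoderOutput k K N => τ w = t)
            ⊆ Finset.univ.filter fun w : DecoderOutput k K N =>
                (correctSet A W w.1).card = N - t := by
          intro w hw
          have hw := (Finset.mem_filter.1 hw).2
          have := card_correctSet_le (A := A) (W := W) w
          simp only [hτ] at hw
          exact Finset.mem_filter.2 ⟨Finset.mem_univ _, by omega⟩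
        have hcount := (Finset.card_le_card hfib).trans
          (card_decoderOutput_correctSet_le (A := A) (W := W) (show N - t + t = N by omega))
        rw [hA] at hcount
        have hexp := choose_mul_choose_mul_pow_le (k := k) (c := N - t) (t := t) hn (by omega)
          hKa hKa0
        rw [show N - t + t = N by omega] at hexp
        have hcount' : ((Finset.univ.filter fun w : DecoderOutput k K N => τ w = t).card : ℝ)
            ≤ Real.exp (n * g t) := le_trans (by exact_mod_cast hcount) hexp
        calc ∑ w with τ w = t, ENNReal.ofReal (Real.exp (-(n * (g (τ w) + η))))
            = ∑ w : DecoderOutput k K N with τ w = t,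
                ENNReal.ofReal (Real.exp (-(n * (g t + η)))) :=
              Finset.sum_congr rfl fun w hw => by rw [(Finset.mem_filter.1 hw).2]
          _ = ENNReal.ofReal ((Finset.univ.filter fun w : DecoderOutput k K N => τ w = t).card
                * Real.exp (-(n * (g t + η)))) := by
              rw [Finset.sum_const, nsmul_eq_mul, ENNReal.ofReal_mul (by positivity),
                ENNReal.ofReal_natCast]
          _ ≤ ENNReal.ofReal (Real.exp (n * g t) * Real.exp (-(n * (g t + η)))) := by gcongr
          _ = ENNReal.ofReal (Real.exp (-(n * η))) := by
              rw [← Real.exp_add]; congr 2; ring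
    _ = ENNReal.ofReal ((N + 1) * Real.exp (-(n * η))) := by
        rw [Finset.sum_const, Finset.card_range, nsmul_eq_mul, ENNReal.ofReal_mul (by positivity)]
        congr 1
        rw [← ENNReal.ofReal_natCast]
        push_cast
        rfl

variable {ext : DecoderOutput k K N → DecoderOutput k K Ka}
  {sel : (Fin n → Fin K × Fin (2 ^ k) → ℂ) × (Fin n → ℂ) × (Fin K → ℂ) → DecoderOutput k K N}

/-- If the selected assignment is outside `B`, the error fraction is at most `ϵ₁`. Otherwise it is
at most one, and some member of `B` has beaten its own competitor; the expected number of such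
events is summed over `B`. -/
theorem lintegral_errorFraction_le_of_excessClose (hn : 0 < n) (hN : N ≤ Ka) (hKa : Ka ≤ K)
    (hKa0 : 0 < Ka) (hA : A.card = Ka) (hδ : 0 ≤ δ) (hϵ : (Ka : ℝ) - N ≤ ϵ₁ * Ka)
    (hsep : SeparationCondition n k K Ka N (s ^ 2) ϵ₁ η δ)
    (hext : ∀ (w : DecoderOutput k K N) j, (w.1 j).isSome = true → (ext w).1 j = w.1 j)
    (hsel : ∀ p (w : DecoderOutput k K N), codeMetric s (sel p).1 p ≤ codeMetric s w.1 p)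
    (hh : ExcessClose A (fun j => ‖h j‖ ^ 2) δ) :
    ∫⁻ z, ∫⁻ G, Scheme.errorFraction A W (ext (sel (observation s A W h z G)))
        ∂gaussianEnsemble n (Fin K × Fin (2 ^ k)) ∂stdComplexGaussianVec n
      ≤ ENNReal.ofReal ϵ₁ + ENNReal.ofReal ((N + 1) * Real.exp (-(n * η))) := by
  classical
  have hKa' : (0 : ℝ) < Ka := by exact_mod_cast hKa0
  set B := Finset.univ.filter fun w : DecoderOutput k K N =>
    ϵ₁ * Ka < Ka - ((correctSet A W w.1).card : ℝ) with hB
  -- The competitor depends on `w` but not on the noise or the codebook, so the union bound runs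
  -- over `w` alone. Outside `B` the choice is immaterial.
  have hex : ∀ w : DecoderOutput k K N, ∃ w₁ : DecoderOutput k K N, w ∈ B →
      ∫⁻ z, ∫⁻ G, {G : Fin n → Fin K × Fin (2 ^ k) → ℂ |
        codeMetric s w.1 (observation s A W h z G)
          ≤ codeMetric s w₁.1 (observation s A W h z G)}.indicator 1 G
        ∂gaussianEnsemble n (Fin K × Fin (2 ^ k)) ∂stdComplexGaussianVec n
      ≤ ENNReal.ofReal (Real.exp (-(n * (gammaExp k (K / n) (Ka / K) (N / Ka)
          ((N - (correctSet A W w.1).card : ℕ) / Ka) + η)))) := by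
    intro w
    by_cases hw : w ∈ B
    · obtain ⟨w₁, hw₁⟩ := exists_better_assignment hN hA hδ hϵ hsep hh w (Finset.mem_filter.1 hw).2
      exact ⟨w₁, fun _ => hw₁⟩
    · exact ⟨w, fun hw' => absurd hw' hw⟩
  choose w₁ hw₁ using hex
  set I : DecoderOutput k K N → (Fin n → ℂ) → (Fin n → Fin K × Fin (2 ^ k) → ℂ) → ℝ≥0∞ :=
    fun w z G => {G : Fin n → Fin K × Fin (2 ^ k) → ℂ |
        codeMetric s w.1 (observation s A W h z G)
          ≤ codeMetric s (w₁ w).1 (observation s A W h z G)}.indicator 1 G with hI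
  have hobs : Measurable fun p : (Fin n → ℂ) × (Fin n → Fin K × Fin (2 ^ k) → ℂ) =>
      observation s A W h p.1 p.2 :=
    (measurable_observation s A W).comp (measurable_const.prodMk measurable_id)
  have hIm : ∀ w, Measurable (Function.uncurry (I w)) := fun w => by
    have hset := measurableSet_le ((measurable_codeMetric s w.1).comp hobs)
      ((measurable_codeMetric s (w₁ w).1).comp hobs)
    exact (measurable_const (a := (1 : ℝ≥0∞))).indicator hset
  have hpt : ∀ z G, Scheme.errorFraction A W (ext (sel (observation s A W h z G)))
      ≤ ENNReal.ofReal ϵ₁ + ∑ w ∈ B, I w z G := by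
    intro z G
    set w := sel (observation s A W h z G) with hw
    by_cases hwB : w ∈ B
    · refine (errorFraction_le_one hA _).trans (le_add_left ?_)
      refine le_trans (le_of_eq ?_) (Finset.single_le_sum (f := fun w => I w z G)
        (fun _ _ => zero_le) hwB)
      simp only [hI]
      rw [Set.indicator_of_mem, Pi.one_apply]
      exact hsel _ _
    · refine (errorFraction_le_of_extension hA (hext w)).trans (le_add_right ?_)
      have h1 : Ka - ((correctSet A W w.1).card : ℝ) ≤ ϵ₁ * Ka := by
        by_contra hlt
        exact hwB (Finset.mem_filter.2 ⟨Finset.mem_univ _, not_le.1 hlt⟩)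
      refine ENNReal.div_le_of_le_mul ?_
      have hc := (card_correctSet_le (A := A) (W := W) w).trans hN
      rw [← ENNReal.ofReal_natCast, ← ENNReal.ofReal_natCast Ka,
        ← ENNReal.ofReal_mul' hKa'.le, Nat.cast_sub hc]
      exact ENNReal.ofReal_le_ofReal h1
  calc _ ≤ ∫⁻ z, ∫⁻ G, (ENNReal.ofReal ϵ₁ + ∑ w ∈ B, I w z G)
        ∂gaussianEnsemble n (Fin K × Fin (2 ^ k)) ∂stdComplexGaussianVec n :=
        lintegral_mono fun z => lintegral_mono fun G => hpt z G
    _ = ENNReal.ofReal ϵ₁ + ∑ w ∈ B, ∫⁻ z, ∫⁻ G, I w z G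
        ∂gaussianEnsemble n (Fin K × Fin (2 ^ k)) ∂stdComplexGaussianVec n := by
        have e : ∀ z, ∫⁻ G, (ENNReal.ofReal ϵ₁ + ∑ w ∈ B, I w z G)
            ∂gaussianEnsemble n (Fin K × Fin (2 ^ k))
            = ENNReal.ofReal ϵ₁ + ∑ w ∈ B, ∫⁻ G, I w z G
              ∂gaussianEnsemble n (Fin K × Fin (2 ^ k)) := by
          intro z
          rw [lintegral_add_left measurable_const, lintegral_const, measure_univ, mul_one,
            lintegral_finsetSum _ fun w _ => (hIm w).of_uncurry_left]
        simp_rw [e]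
        rw [lintegral_add_left measurable_const, lintegral_const, measure_univ, mul_one,
          lintegral_finsetSum _ fun w _ => (hIm w).lintegral_prod_right]
    _ ≤ _ := by
        gcongr
        exact (Finset.sum_le_sum fun w hw => hw₁ w hw).trans
          (sum_exp_gammaExp_le hn hN hKa hKa0 hA B)

/-- The scheme with codebook `s • G` and the decoder `ext ∘ sel`. -/
def gaussianScheme (s : ℝ) (ext : DecoderOutput k K N → DecoderOutput k K Ka)
    (sel : (Fin n → Fin K × Fin (2 ^ k) → ℂ) × (Fin n → ℂ) × (Fin K → ℂ) → DecoderOutput k K N)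
    (hsel : Measurable[_, ⊤] sel) (G : Fin n → Fin K × Fin (2 ^ k) → ℂ) : Scheme n k K Ka where
  codebook j m i := s * G i (j, m)
  encoder _ m := PMF.pure m
  decoder p := PMF.pure (ext (sel (G, p)))
  measurable_decoder w := by
    classical
    let _ : MeasurableSpace (DecoderOutput k K N) := ⊤
    simp only [PMF.pure_apply]
    have hp : Measurable fun p : (Fin n → ℂ) × (Fin K → ℂ) => sel (G, p) :=
      hsel.comp (measurable_const.prodMk measurable_id)
    exact (measurable_from_top (f := fun v => if w = ext v then (1 : ℝ≥0∞) else 0)).comp hp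

theorem condError_gaussianScheme (s : ℝ) (ext : DecoderOutput k K N → DecoderOutput k K Ka)
    (hsel : Measurable[_, ⊤] sel) (G : Fin n → Fin K × Fin (2 ^ k) → ℂ) (A : Finset (Fin K))
    (W : Fin K → Fin (2 ^ k)) :
    (gaussianScheme s ext sel hsel G).condError A W W
      = ∫⁻ h, ∫⁻ z, Scheme.errorFraction A W (ext (sel (observation s A W h z G)))
        ∂stdComplexGaussianVec n ∂stdComplexGaussianVec K := by
  classical
  unfold Scheme.condError
  refine lintegral_congr fun h => lintegral_congr fun z => ?_
  have hobs : observation s A W h z G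
      = (G, (gaussianScheme s ext sel hsel G).received A W h z, h) := by
    unfold observation Scheme.received
    congr 2
    funext i
    rw [sum_graph_restrictMessages, add_comm]
    simp only [gaussianScheme, mul_assoc]
  rw [hobs]
  simp only [gaussianScheme, PMF.pure_apply]
  rw [Finset.sum_eq_single (ext (sel (G, _, h)))]
  · rw [if_pos rfl, one_mul]
  · intro w _ hw
    rw [if_neg hw, zero_mul]
  · simp

theorem measurable_errorFraction_observation (s : ℝ)
    (ext : DecoderOutput k K N → DecoderOutput k K Ka)
    (hsel : Measurable[_, ⊤] sel) (A : Finset (Fin K)) (W : Fin K → Fin (2 ^ k)) :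
    Measurable fun p : (Fin K → ℂ) × (Fin n → ℂ) × (Fin n → Fin K × Fin (2 ^ k) → ℂ) =>
      Scheme.errorFraction A W (ext (sel (observation s A W p.1 p.2.1 p.2.2))) := by
  let _ : MeasurableSpace (DecoderOutput k K N) := ⊤
  exact (measurable_from_top (f := fun v => Scheme.errorFraction A W (ext v))).comp
    (hsel.comp (measurable_observation s A W))

theorem measurable_condError_gaussianScheme (s : ℝ)
    (ext : DecoderOutput k K N → DecoderOutput k K Ka)
    (hsel : Measurable[_, ⊤] sel) (A : Finset (Fin K)) (W : Fin K → Fin (2 ^ k)) :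
    Measurable fun G => (gaussianScheme s ext sel hsel G).condError A W W := by
  simp_rw [condError_gaussianScheme]
  exact (measurable_lintegral_middle (f := fun h z G =>
    Scheme.errorFraction A W (ext (sel (observation s A W h z G)))) _
    (measurable_errorFraction_observation s ext hsel A W)).lintegral_prod_right'

theorem lintegral_condError_gaussianScheme_le {β : ℝ≥0∞} (hn : 0 < n) (hN : N ≤ Ka) (hKa : Ka ≤ K)
    (hKa0 : 0 < Ka) (hA : A.card = Ka) (hδ : 0 ≤ δ) (hϵ : (Ka : ℝ) - N ≤ ϵ₁ * Ka)
    (hsep : SeparationCondition n k K Ka N (s ^ 2) ϵ₁ η δ)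
    (hext : ∀ (w : DecoderOutput k K N) j, (w.1 j).isSome = true → (ext w).1 j = w.1 j)
    (hsel : ∀ p (w : DecoderOutput k K N), codeMetric s (sel p).1 p ≤ codeMetric s w.1 p)
    (hselm : Measurable[_, ⊤] sel)
    (hβ : stdComplexGaussianVec K {h | ¬ ExcessClose A (fun j => ‖h j‖ ^ 2) δ} ≤ β) :
    ∫⁻ G, (gaussianScheme s ext sel hselm G).condError A W W
        ∂gaussianEnsemble n (Fin K × Fin (2 ^ k))
      ≤ ENNReal.ofReal ϵ₁ + ENNReal.ofReal ((N + 1) * Real.exp (-(n * η))) + β := by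
  simp_rw [condError_gaussianScheme]
  rw [lintegral_rotate (f := fun h z G =>
    Scheme.errorFraction A W (ext (sel (observation s A W h z G)))) _ _ _
    (measurable_errorFraction_observation s ext hselm A W)]
  set bad := {h : Fin K → ℂ | ¬ ExcessClose A (fun j => ‖h j‖ ^ 2) δ} with hbad
  set c := ENNReal.ofReal ϵ₁ + ENNReal.ofReal ((N + 1) * Real.exp (-(n * η))) with hc
  have hpt : ∀ h : Fin K → ℂ, ∫⁻ z, ∫⁻ G,
      Scheme.errorFraction A W (ext (sel (observation s A W h z G)))
        ∂gaussianEnsemble n (Fin K × Fin (2 ^ k)) ∂stdComplexGaussianVec n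
      ≤ c + bad.indicator 1 h := by
    intro h
    by_cases hh : ExcessClose A (fun j => ‖h j‖ ^ 2) δ
    · exact (lintegral_errorFraction_le_of_excessClose hn hN hKa hKa0 hA hδ hϵ hsep hext hsel
        hh).trans le_self_add
    · rw [Set.indicator_of_mem (show h ∈ bad from hh), Pi.one_apply]
      refine le_add_left ?_
      calc _ ≤ ∫⁻ _z : Fin n → ℂ, ∫⁻ _G, 1 ∂gaussianEnsemble n (Fin K × Fin (2 ^ k))
            ∂stdComplexGaussianVec n :=
            lintegral_mono fun z => lintegral_mono fun G => errorFraction_le_one hA _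
        _ = 1 := by simp
  refine (lintegral_mono hpt).trans ?_
  rw [lintegral_add_left measurable_const, lintegral_const, measure_univ, mul_one]
  gcongr
  exact (lintegral_indicator_one_le _).trans hβ

/-- A finite-blocklength achievability bound. -/
theorem existsCode_of_separationCondition {δ C r : ℝ} {ϵ : ℝ≥0∞} {e : ℝ≥0}
    (hC : ∀ A : Finset (Fin K), A.Nonempty →
      stdComplexGaussianVec K {h | ¬ ExcessClose A (fun j => ‖h j‖ ^ 2) δ}
        ≤ ENNReal.ofReal (C / A.card))
    (hn : 0 < n) (hN : N ≤ Ka) (hKa : Ka ≤ K) (hKa0 : 0 < Ka) (hδ : 0 ≤ δ)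
    (hϵ : (Ka : ℝ) - N ≤ ϵ₁ * Ka) (hsep : SeparationCondition n k K Ka N (s ^ 2) ϵ₁ η δ)
    (hr : 1 < r) (hpow : s ^ 2 * (n * r) ≤ e * k) (hϵ1 : ϵ ≤ 1)
    (hlt : ENNReal.ofReal ϵ₁ + ENNReal.ofReal ((N + 1) * Real.exp (-(n * η)))
      + ENNReal.ofReal (C / Ka)
      + (K * 2 ^ k : ℕ) * ENNReal.ofReal ((r * Real.exp (1 - r)) ^ n) < ϵ) :
    ExistsCode n k ϵ e K Ka := by
  have hn' : (0 : ℝ) < n := by exact_mod_cast hn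
  have := nonempty_decoderOutput (k := k) (hN.trans hKa)
  obtain ⟨sel, hselm, hsel⟩ := exists_measurable_argmin
    (fun w : DecoderOutput k K N => codeMetric (n := n) s w.1)
    fun w => measurable_codeMetric s w.1
  choose ext hext using fun w : DecoderOutput k K N => exists_extension hN hKa w
  set μG := gaussianEnsemble n (Fin K × Fin (2 ^ k)) with hμG
  set bad := {G : Fin n → Fin K × Fin (2 ^ k) → ℂ | ∃ l, n * r < ∑ i, ‖G i l‖ ^ 2} with hbad
  have hbadm : MeasurableSet bad := by
    have : bad = ⋃ l, {G | n * r < ∑ i, ‖G i l‖ ^ 2} := by ext G; simp [hbad]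
    rw [this]
    exact MeasurableSet.iUnion fun l => measurableSet_lt measurable_const (by fun_prop)
  have h1 : ∫⁻ G, (gaussianScheme s ext sel hselm G).pupe ∂μG
      ≤ ENNReal.ofReal ϵ₁ + ENNReal.ofReal ((N + 1) * Real.exp (-(n * η)))
        + ENNReal.ofReal (C / Ka) := by
    refine Scheme.lintegral_pupe_le hKa _ (fun _ _ _ => rfl)
      (fun A W => measurable_condError_gaussianScheme s ext hselm A W) fun A W hA => ?_
    refine lintegral_condError_gaussianScheme_le hn hN hKa hKa0 hA hδ hϵ hsep hext hsel hselm ?_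
    rw [← hA]
    exact hC A (by rw [← Finset.card_pos, hA]; exact hKa0)
  have h2 : μG bad ≤ (K * 2 ^ k : ℕ) * ENNReal.ofReal ((r * Real.exp (1 - r)) ^ n) := by
    refine (gaussianEnsemble_power_le hr).trans (le_of_eq ?_)
    rw [Fintype.card_prod, Fintype.card_fin, Fintype.card_fin]
  -- Adding the indicator of excessive power handles both requirements at once: as `ϵ ≤ 1`, a
  -- codebook for which the sum is below `ϵ` has small error and is not in `bad`.
  have h3 : ∫⁻ G, ((gaussianScheme s ext sel hselm G).pupe + bad.indicator 1 G) ∂μG < ϵ := by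
    rw [lintegral_add_right _ (measurable_one.indicator hbadm), lintegral_indicator_one hbadm]
    exact (add_le_add h1 h2).trans_lt hlt
  obtain ⟨G, hG⟩ : ∃ G, (gaussianScheme s ext sel hselm G).pupe + bad.indicator 1 G < ϵ := by
    by_contra hcon
    push Not at hcon
    refine absurd h3 (not_lt.2 ?_)
    calc ϵ = ∫⁻ _G, ϵ ∂μG := by simp
      _ ≤ _ := lintegral_mono hcon
  have hGbad : G ∉ bad := by
    intro hmem
    rw [Set.indicator_of_mem hmem, Pi.one_apply] at hG
    exact absurd (hG.trans_le hϵ1) (not_lt.2 le_add_self)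
  refine ⟨gaussianScheme s ext sel hselm G, fun j m => ?_, (le_self_add.trans_lt hG).le⟩
  have hle : ∑ i, ‖G i (j, m)‖ ^ 2 ≤ n * r := by
    by_contra hlt'
    exact hGbad ⟨(j, m), not_le.1 hlt'⟩
  calc ∑ i, ‖(gaussianScheme s ext sel hselm G).codebook j m i‖ ^ 2
      = s ^ 2 * ∑ i, ‖G i (j, m)‖ ^ 2 := by
        rw [Finset.mul_sum]
        refine Finset.sum_congr rfl fun i _ => ?_
        simp only [gaussianScheme, norm_mul, Complex.norm_real, mul_pow, Real.norm_eq_abs, sq_abs]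
    _ ≤ s ^ 2 * (n * r) := by gcongr
    _ ≤ e * k := hpow
    _ = n * (e * k / n) := by field_simp

end MinimumDistance

/-! ### Continuity and compactness above the threshold. -/

theorem continuous_xi : Continuous fun p : ℝ × ℝ => xi p.1 p.2 := by
  have h1 : Continuous fun p : ℝ × ℝ => p.1 * Real.log p.1 :=
    Real.continuous_mul_log.comp continuous_fst
  have h2 : Continuous fun p : ℝ × ℝ => p.2 * Real.log p.2 :=
    Real.continuous_mul_log.comp continuous_snd
  exact ((h1.sub h2).add continuous_snd).sub continuous_fst

theorem ContinuousAt.xi {X : Type*} [TopologicalSpace X] {f g : X → ℝ} {x : X}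
    (hf : ContinuousAt f x) (hg : ContinuousAt g x) :
    ContinuousAt (fun y => MassiveAccess.xi (f y) (g y)) x :=
  ContinuousAt.comp (f := fun y => (f y, g y)) continuous_xi.continuousAt (hf.prodMk hg)

theorem ContinuousAt.gammaExp {X : Type*} [TopologicalSpace X] {k : ℕ} {μ pa ν θ : X → ℝ} {x : X}
    (hμ : ContinuousAt μ x) (hpa : ContinuousAt pa x) (hν : ContinuousAt ν x)
    (hθ : ContinuousAt θ x) (h0 : 1 + θ x * pa x - ν x * pa x ≠ 0) :
    ContinuousAt (fun y => MassiveAccess.gammaExp k (μ y) (pa y) (ν y) (θ y)) x := by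
  have hb : ∀ {f : X → ℝ}, ContinuousAt f x → ContinuousAt (fun y => Real.binEntropy (f y)) x :=
    fun hf => Real.binEntropy_continuous.continuousAt.comp hf
  have h1 := hb ((continuousAt_const (y := (1 : ℝ))).sub hν |>.add hθ)
  have h2 := hb ((hθ.mul hpa).div (((continuousAt_const (y := (1 : ℝ))).add (hθ.mul hpa)).sub
    (hν.mul hpa)) h0)
  have h3 := ((continuousAt_const (y := (1 : ℝ))).sub (hν.mul hpa)).add (hθ.mul hpa)
  exact (((hpa.mul hμ).mul h1).add ((hμ.mul h3).mul h2)).add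
    (((hθ.mul hpa).mul hμ).mul continuousAt_const)

theorem gammaExp_pos {k : ℕ} (hk : 0 < k) {μ pa ν θ : ℝ} (hμ : 0 < μ) (hpa : pa ∈ Set.Ioc (0 : ℝ) 1)
    (hν : ν ≤ 1) (hθ0 : 0 < θ) (hθν : θ ≤ ν) : 0 < gammaExp k μ pa ν θ := by
  have hpa0 := hpa.1
  have h1 : 0 < θ * pa := mul_pos hθ0 hpa0
  have h2 : ν * pa ≤ 1 := mul_le_one₀ hν hpa0.le hpa.2
  have e1 : 0 ≤ Real.binEntropy (1 - ν + θ) :=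
    Real.binEntropy_nonneg (by linarith) (by linarith)
  have e2 : 0 ≤ Real.binEntropy (θ * pa / (1 + θ * pa - ν * pa)) := by
    have hd : 0 < 1 + θ * pa - ν * pa := by linarith
    exact Real.binEntropy_nonneg (by positivity) (by rw [div_le_one hd]; linarith)
  have e3 : 0 < Real.log ((2 : ℝ) ^ k) :=
    Real.log_pos (one_lt_pow₀ (by norm_num) hk.ne')
  have e4 : 0 < 1 - ν * pa + θ * pa := by linarith
  unfold gammaExp
  positivity

/-- The margin by which the signal beats noise and interference, when the total power of the active
users is `E`, up to deviations `η` of the parameters. -/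
def margin (k : ℕ) (μ pa ν η E θ ψ : ℝ) : ℝ :=
  E * (xi ψ (ψ + θ) - η)
    - 4 * (Real.exp (gammaExp k μ pa ν θ + η) - 1) * (1 + E * (xi (ψ + θ) (ψ + θ + 1 - ν) + η))

theorem ContinuousAt.margin {X : Type*} [TopologicalSpace X] {k : ℕ}
    {μ pa ν η E θ ψ : X → ℝ} {x : X}
    (hμ : ContinuousAt μ x) (hpa : ContinuousAt pa x) (hν : ContinuousAt ν x)
    (hη : ContinuousAt η x) (hE : ContinuousAt E x)
    (hθ : ContinuousAt θ x) (hψ : ContinuousAt ψ x) (h0 : 1 + θ x * pa x - ν x * pa x ≠ 0) :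
    ContinuousAt
      (fun y => MassiveAccess.margin k (μ y) (pa y) (ν y) (η y) (E y) (θ y) (ψ y)) x := by
  have h1 := ContinuousAt.gammaExp (k := k) hμ hpa hν hθ h0
  have h2 := ContinuousAt.xi hψ (hψ.add hθ)
  have h3 := ContinuousAt.xi (hψ.add hθ)
    (((hψ.add hθ).add (continuousAt_const (y := (1 : ℝ)))).sub hν)
  have h4 := (Real.continuous_exp.continuousAt.comp (h1.add hη)).sub
    (continuousAt_const (y := (1 : ℝ)))
  exact (hE.mul (h2.sub hη)).sub (((continuousAt_const (y := (4 : ℝ))).mul h4).mul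
    ((continuousAt_const (y := (1 : ℝ))).add (hE.mul (h3.add hη))))

section Threshold

variable {k : ℕ} {μ pa ϵ ν : ℝ}

/-- Clearing the denominator in `powerBound`. Since `γ > 0`, the numerator is positive, so a
nonpositive denominator would make the quotient infinite. -/
theorem margin_nonneg_of_powerBound_le {θ ψ e : ℝ} (hS : 0 < pa * μ * k)
    (hγ : 0 < gammaExp k μ pa ν θ)
    (h : powerBound k μ pa ν θ ψ / ENNReal.ofReal (pa * μ * k) ≤ ENNReal.ofReal e) :
    0 ≤ margin k μ pa ν 0 (e * (pa * μ * k)) θ ψ := by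
  have hnum : 0 < 4 * (Real.exp (gammaExp k μ pa ν θ) - 1) := by
    have := Real.one_lt_exp_iff.2 hγ
    linarith
  set num := 4 * (Real.exp (gammaExp k μ pa ν θ) - 1) with hnumdef
  have hS0 : ENNReal.ofReal (pa * μ * k) ≠ 0 := by simpa using hS
  rw [ENNReal.div_le_iff hS0 ENNReal.ofReal_ne_top, ← ENNReal.ofReal_mul' hS.le] at h
  unfold powerBound at h
  rw [← hnumdef] at h
  set D := xi ψ (ψ + θ) - num * xi (ψ + θ) (ψ + θ + 1 - ν) with hD
  have hm : margin k μ pa ν 0 (e * (pa * μ * k)) θ ψ = e * (pa * μ * k) * D - num := by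
    simp only [margin, add_zero, sub_zero, ← hnumdef, hD]; ring
  rw [hm]
  rcases le_or_gt D 0 with hD0 | hD0
  · rw [ENNReal.ofReal_of_nonpos hD0, ENNReal.div_zero (by simpa using hnum), top_le_iff] at h
    exact absurd h ENNReal.ofReal_ne_top
  · rw [← ENNReal.ofReal_div_of_pos hD0] at h
    have h' : num / D ≤ e * (pa * μ * k) := by
      by_contra hlt
      exact absurd h (not_le.2 ((ENNReal.ofReal_lt_ofReal_iff (by positivity)).2 (not_le.1 hlt)))
    rw [div_le_iff₀ hD0] at h'
    linarith

/-- The supremum leaves out `θ = ϵ - 1 + ν`, but compactness requires this edge; it is reached as a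
limit along a segment toward `(ν, 0)`. This gives a nonnegative margin at an intermediate energy
`e₁`. The margin is affine in the energy and negative at energy zero, so its slope is positive and
the margin at `e > e₁` is positive. -/
theorem margin_pos_of_csirThreshold_lt (hk : 0 < k) (hμ : 0 < μ) (hpa : pa ∈ Set.Ioc (0 : ℝ) 1)
    (hϵ : ϵ < 1) (hν : ν ∈ Set.Ioc (1 - ϵ) 1) {e : ℝ≥0} (he : csirThreshold k μ pa ϵ ν < e)
    {θ ψ : ℝ} (hθ : θ ∈ Set.Icc (ϵ - 1 + ν) ν) (hψ : ψ ∈ Set.Icc 0 (ν - θ)) :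
    0 < margin k μ pa ν 0 (e * (pa * μ * k)) θ ψ := by
  have hpa0 := hpa.1
  have hS : 0 < pa * μ * k := by positivity
  have hν1 := hν.1
  have hθ1 := hθ.1
  have hθ0 : 0 < θ := by linarith
  have h2 : ν * pa ≤ 1 := mul_le_one₀ hν.2 hpa0.le hpa.2
  obtain ⟨e₁, he₁, he₁e⟩ := ENNReal.lt_iff_exists_nnreal_btwn.1 he
  have he₁e : (e₁ : ℝ) < e := by exact_mod_cast he₁e
  have hpath : ∀ τ ∈ Set.Ioc (0 : ℝ) 1,
      0 ≤ margin k μ pa ν 0 (e₁ * (pa * μ * k)) (θ + (ν - θ) * τ) ((1 - τ) * ψ) := by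
    intro τ hτ
    have h3 : 0 ≤ ν - θ := by linarith [hθ.2]
    have hθ' : θ + (ν - θ) * τ ∈ Set.Ioc (ϵ - 1 + ν) ν := by
      constructor
      · rcases h3.eq_or_lt with h | h
        · rw [← h]; linarith
        · nlinarith [mul_pos h hτ.1]
      · nlinarith [hτ.2]
    have hψ' : (1 - τ) * ψ ∈ Set.Icc 0 (ν - (θ + (ν - θ) * τ)) := by
      have := hτ.2
      constructor
      · exact mul_nonneg (by linarith) hψ.1
      · nlinarith [mul_le_mul_of_nonneg_left hψ.2 (by linarith : 0 ≤ 1 - τ)]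
    refine margin_nonneg_of_powerBound_le hS
      (gammaExp_pos hk hμ hpa hν.2 (by linarith [hθ'.1]) hθ'.2) ?_
    rw [ENNReal.ofReal_coe_nnreal]
    refine le_trans ?_ he₁.le
    unfold csirThreshold
    exact le_trans (le_iSup₂ (f := fun ψ (_ : ψ ∈ Set.Icc 0 (ν - (θ + (ν - θ) * τ))) =>
        powerBound k μ pa ν (θ + (ν - θ) * τ) ψ / ENNReal.ofReal (pa * μ * k)) _ hψ')
      (le_iSup₂ (f := fun θ (_ : θ ∈ Set.Ioc (ϵ - 1 + ν) ν) => ⨆ ψ ∈ Set.Icc 0 (ν - θ),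
        powerBound k μ pa ν θ ψ / ENNReal.ofReal (pa * μ * k)) _ hθ')
  have h0 : 0 ≤ margin k μ pa ν 0 (e₁ * (pa * μ * k)) θ ψ := by
    have hc : ContinuousAt (fun τ : ℝ =>
        margin k μ pa ν 0 (e₁ * (pa * μ * k)) (θ + (ν - θ) * τ) ((1 - τ) * ψ)) 0 := by
      refine ContinuousAt.margin continuousAt_const continuousAt_const continuousAt_const
        continuousAt_const continuousAt_const (by fun_prop) (by fun_prop) ?_
      have : 0 < θ * pa := mul_pos hθ0 hpa0
      simp only [mul_zero, add_zero]
      linarith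
    have ht := hc.tendsto.mono_left (nhdsWithin_le_nhds (s := Set.Ioi 0))
    simp only [mul_zero, add_zero, sub_zero, one_mul] at ht
    refine ge_of_tendsto ht ?_
    filter_upwards [Ioc_mem_nhdsGT (zero_lt_one' ℝ)] with τ hτ using hpath τ hτ
  have hγ := gammaExp_pos hk hμ hpa hν.2 hθ0 hθ.2
  have hexp := Real.one_lt_exp_iff.2 hγ
  simp only [margin, add_zero, sub_zero] at h0 ⊢
  set num := 4 * (Real.exp (gammaExp k μ pa ν θ) - 1) with hnumdef
  have hnum : 0 < num := by rw [hnumdef]; linarith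
  set x₁ := xi ψ (ψ + θ)
  set x₂ := xi (ψ + θ) (ψ + θ + 1 - ν)
  set S := pa * μ * k
  have hD : 0 < e₁ * S * (x₁ - num * x₂) := by linarith
  have hD' : 0 < x₁ - num * x₂ := by
    by_contra hneg
    have : e₁ * S * (x₁ - num * x₂) ≤ 0 :=
      mul_nonpos_of_nonneg_of_nonpos (by positivity) (not_lt.1 hneg)
    linarith
  nlinarith [mul_pos (mul_pos (sub_pos.2 he₁e) hS) hD']

theorem exists_uniform_margin (hk : 0 < k) (hμ : 0 < μ) (hpa : pa ∈ Set.Ioc (0 : ℝ) 1)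
    (hϵ : ϵ < 1) (hν : ν ∈ Set.Ioc (1 - ϵ) 1) {e : ℝ≥0} (he : csirThreshold k μ pa ϵ ν < e) :
    ∃ ρ > 0, ∀ μ' pa' ν' η E θ ψ : ℝ, |μ' - μ| < ρ → |pa' - pa| < ρ → |ν' - ν| < ρ → |η| < ρ →
      |E - e * (pa * μ * k)| < ρ → ϵ - 1 + ν - ρ < θ → θ ≤ ν → 0 ≤ ψ → ψ ≤ ν - θ →
      0 < gammaExp k μ' pa' ν' θ ∧ 0 < margin k μ' pa' ν' η E θ ψ := by
  have hν1 := hν.1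
  have hpa0 := hpa.1
  have h2 : ν * pa ≤ 1 := mul_le_one₀ hν.2 hpa0.le hpa.2
  set D : Set (ℝ × ℝ) := {y | y.1 ∈ Set.Icc (ϵ - 1 + ν) ν ∧ y.2 ∈ Set.Icc 0 (ν - y.1)} with hD
  have hDc : IsCompact D := by
    refine (isCompact_Icc (a := ((ϵ - 1 + ν, 0) : ℝ × ℝ)) (b := (ν, 1 - ϵ))).of_isClosed_subset
      ?_ ?_
    · have : D = {y : ℝ × ℝ | ϵ - 1 + ν ≤ y.1} ∩ {y | y.1 ≤ ν} ∩ {y | 0 ≤ y.2}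
          ∩ {y | y.2 ≤ ν - y.1} := by
        ext y
        simp only [hD, Set.mem_ofPred_eq, Set.mem_Icc, Set.mem_inter_iff]
        tauto
      rw [this]
      exact (((isClosed_le (by fun_prop) (by fun_prop)).inter
        (isClosed_le (by fun_prop) (by fun_prop))).inter
        (isClosed_le (by fun_prop) (by fun_prop))).inter
        (isClosed_le (by fun_prop) (by fun_prop))
    · rintro ⟨a, b⟩ ⟨⟨h1, h2⟩, h3, h4⟩
      simp only at h1 h2 h3 h4
      exact ⟨⟨h1, h3⟩, ⟨h2, by simp only; linarith⟩⟩
  -- The last two perturbation coordinates shift `θ` and `ψ`, so the conclusion reaches pairs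
  -- slightly outside `D`, as rounding will require.
  have hev := hDc.eventually_forall_of_forall_eventually
    (x₀ := ((μ, pa, ν, 0, e * (pa * μ * k), 0, 0) : ℝ × ℝ × ℝ × ℝ × ℝ × ℝ × ℝ))
    (P := fun x y => 0 < gammaExp k x.1 x.2.1 x.2.2.1 (y.1 + x.2.2.2.2.2.1) ∧
      0 < margin k x.1 x.2.1 x.2.2.1 x.2.2.2.1 x.2.2.2.2.1 (y.1 + x.2.2.2.2.2.1)
        (y.2 + x.2.2.2.2.2.2)) ?_
  · obtain ⟨ρ, hρ, hball⟩ := Metric.eventually_nhds_iff.1 hev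
    refine ⟨ρ, hρ, fun μ' pa' ν' η E θ ψ a1 a2 a3 a4 a5 b1 b2 b3 b4 => ?_⟩
    have hP : ∀ y ∈ D, |θ - y.1| < ρ → |ψ - y.2| < ρ → 0 < gammaExp k μ' pa' ν' θ ∧
        0 < margin k μ' pa' ν' η E θ ψ := by
      intro y hy c1 c2
      have := @hball (μ', pa', ν', η, E, θ - y.1, ψ - y.2) (by
        simp only [Prod.dist_eq, Real.dist_eq, sub_zero, max_lt_iff]
        exact ⟨a1, a2, a3, a4, a5, c1, c2⟩) y hy
      simpa using this
    rcases le_or_gt (ϵ - 1 + ν) θ with hθ | hθ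
    · exact hP (θ, ψ) ⟨⟨hθ, b2⟩, b3, b4⟩ (by simpa using hρ) (by simpa using hρ)
    -- A pair to the left of `D` is replaced by one on its left edge, with `ψ` truncated to the
    -- height `1 - ϵ` of that edge; both coordinates move by less than `ρ`.
    · refine hP (ϵ - 1 + ν, min ψ (1 - ϵ)) ⟨⟨le_rfl, by simp only; linarith⟩,
        le_min b3 (by linarith), by
          simp only
          exact (min_le_right _ _).trans (by linarith)⟩ ?_ ?_
      · rw [abs_lt]; constructor <;> simp only <;> linarith
      · rw [abs_lt]
        simp only
        rcases le_total ψ (1 - ϵ) with h | h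
        · rw [min_eq_left h]; constructor <;> linarith
        · rw [min_eq_right h]; constructor <;> linarith
  · rintro ⟨θ, ψ⟩ ⟨hθ, hψ⟩
    simp only at hθ hψ
    have hθ0 : 0 < θ := by linarith [hθ.1]
    have hne : 1 + (θ + 0) * pa - ν * pa ≠ 0 := by
      have : 0 < θ * pa := mul_pos hθ0 hpa0
      rw [add_zero]
      linarith
    refine Eventually.and ?_ ?_
    · refine ContinuousAt.eventually_lt continuousAt_const
        (ContinuousAt.gammaExp (by fun_prop) (by fun_prop) (by fun_prop) (by fun_prop) hne) ?_
      simpa using gammaExp_pos hk hμ hpa hν.2 hθ0 hθ.2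
    · refine ContinuousAt.eventually_lt continuousAt_const
        (ContinuousAt.margin (by fun_prop) (by fun_prop) (by fun_prop) (by fun_prop) (by fun_prop)
          (by fun_prop) (by fun_prop) hne) ?_
      simpa using margin_pos_of_csirThreshold_lt hk hμ hpa hϵ hν he hθ hψ

end Threshold

/-! ### Asymptotics in the blocklength. -/

theorem eventually_existsCode {k : ℕ} (hk : 0 < k) {μ pa ϵ ν : ℝ}
    (hμ : μ ∈ Set.Ioo (0 : ℝ) 1) (hpa : pa ∈ Set.Ioc (0 : ℝ) 1) (hϵ0 : 0 < ϵ) (hϵ : ϵ < 1)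
    (hν : ν ∈ Set.Ioc (1 - ϵ) 1) {K Ka : ℕ → ℕ} (hKa_le : ∀ n, Ka n ≤ K n)
    (hK : Tendsto (fun n : ℕ => (K n : ℝ) / (n : ℝ)) atTop (𝓝 μ))
    (hKa : Tendsto (fun n : ℕ => (Ka n : ℝ) / (K n : ℝ)) atTop (𝓝 pa))
    {e : ℝ≥0} (he : csirThreshold k μ pa ϵ ν < e) :
    ∀ᶠ n in atTop, ExistsCode n k (ENNReal.ofReal ϵ) e (K n) (Ka n) := by
  have hν1 := hν.1
  have hν0 : 0 ≤ ν := by linarith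
  -- The codebook is drawn with the smaller energy `e₂`; the ratio `r = e / e₂ > 1` leaves room for
  -- the fluctuation of the codeword norms.
  obtain ⟨e₂, he₂, he₂e⟩ := ENNReal.lt_iff_exists_nnreal_btwn.1 he
  have he₂e : (e₂ : ℝ) < e := by exact_mod_cast he₂e
  have he₂0 : (0 : ℝ) < e₂ := by
    have : (0 : ℝ≥0∞) < e₂ := (zero_le).trans_lt he₂
    exact_mod_cast this
  obtain ⟨ρ, hρ, hmargin⟩ := exists_uniform_margin hk hμ.1 hpa hϵ hν he₂
  set η := ρ / 2 with hη
  obtain ⟨C, hC⟩ := exists_measure_not_excessClose_le (δ := η / 2) (by positivity)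
  -- The target is lowered to `ϵ - σ`, while `N / Ka` is within `σ` of `ν`. The bound `2 * σ ≤ ϵ - 1
  -- + ν` makes the undeclared fraction at most `ϵ - σ`, and `2 * σ ≤ ρ` keeps `θ` above `ϵ - 1 + ν
  -- - ρ`.
  set σ := min ρ (ϵ - 1 + ν) / 2 with hσ
  have hσ0 : 0 < σ := by
    have : 0 < min ρ (ϵ - 1 + ν) := lt_min hρ (by linarith)
    positivity
  have hσρ : 2 * σ ≤ ρ := by rw [hσ]; linarith [min_le_left ρ (ϵ - 1 + ν)]
  have hσϵ : 2 * σ ≤ ϵ - 1 + ν := by rw [hσ]; linarith [min_le_right ρ (ϵ - 1 + ν)]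
  set r : ℝ := e / e₂ with hr
  have hr1 : 1 < r := by rw [hr, one_lt_div he₂0]; exact he₂e
  set q := r * Real.exp (1 - r) with hq
  have hq0 : 0 ≤ q := by positivity
  have hq1 : q < 1 := by
    have h1 := Real.add_one_lt_exp (x := r - 1) (by linarith)
    rw [hq, show 1 - r = -(r - 1) by ring, Real.exp_neg, ← div_eq_mul_inv,
      div_lt_one (Real.exp_pos _)]
    linarith
  have hKan : Tendsto (fun n : ℕ => (Ka n : ℝ) / n) atTop (𝓝 (pa * μ)) := by
    refine (hKa.mul hK).congr fun n => ?_
    rcases Nat.eq_zero_or_pos (K n) with h0 | h0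
    · have : Ka n = 0 := by have := hKa_le n; omega
      simp [h0, this]
    · have : (K n : ℝ) ≠ 0 := by positivity
      field_simp
  have hKatop : Tendsto (fun n : ℕ => (Ka n : ℝ)) atTop atTop := by
    refine (hKan.pos_mul_atTop (mul_pos hpa.1 hμ.1) tendsto_natCast_atTop_atTop).congr' ?_
    filter_upwards [eventually_gt_atTop 0] with n hn
    have : (n : ℝ) ≠ 0 := by positivity
    field_simp
  have hN : Tendsto (fun n : ℕ => (⌊ν * Ka n⌋₊ : ℝ) / Ka n) atTop (𝓝 ν) :=
    (tendsto_nat_floor_mul_div_atTop hν0).comp hKatop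
  have hE : Tendsto (fun n : ℕ => (e₂ : ℝ) * k / n * Ka n) atTop (𝓝 (e₂ * (pa * μ * k))) := by
    rw [show (e₂ : ℝ) * (pa * μ * k) = e₂ * k * (pa * μ) by ring]
    refine (hKan.const_mul ((e₂ : ℝ) * k)).congr fun n => ?_
    ring
  have hclose : ∀ {f : ℕ → ℝ} {a d : ℝ}, Tendsto f atTop (𝓝 a) → 0 < d →
      ∀ᶠ n in atTop, |f n - a| < d := fun hf hd => by
    simpa only [Real.dist_eq] using Metric.tendsto_nhds.1 hf _ hd
  have hsmall : ∀ᶠ n : ℕ in atTop, ENNReal.ofReal (ϵ - σ)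
      + ENNReal.ofReal ((n + 1) * Real.exp (-(n * η))) + ENNReal.ofReal (C / Ka n)
      + ENNReal.ofReal (2 ^ k * (n * q ^ n)) < ENNReal.ofReal ϵ := by
    have t1 : Tendsto (fun n : ℕ => ((n : ℝ) + 1) * Real.exp (-(n * η))) atTop (𝓝 0) := by
      have hx0 := Real.exp_nonneg (-η)
      have hx1 : Real.exp (-η) < 1 := Real.exp_lt_one_iff.2 (by rw [hη]; linarith)
      have := (tendsto_self_mul_const_pow_of_lt_one hx0 hx1).add
        (tendsto_pow_atTop_nhds_zero_of_lt_one hx0 hx1)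
      rw [add_zero] at this
      refine this.congr fun n => ?_
      rw [← Real.exp_nat_mul, mul_neg]
      ring
    have t2 : Tendsto (fun n : ℕ => C / (Ka n : ℝ)) atTop (𝓝 0) := hKatop.const_div_atTop C
    have t3 : Tendsto (fun n : ℕ => (2 : ℝ) ^ k * (n * q ^ n)) atTop (𝓝 0) := by
      simpa using (tendsto_self_mul_const_pow_of_lt_one hq0 hq1).const_mul ((2 : ℝ) ^ k)
    have ht := (((tendsto_const_nhds (x := ENNReal.ofReal (ϵ - σ))).add
      (ENNReal.tendsto_ofReal t1)).add (ENNReal.tendsto_ofReal t2)).add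
      (ENNReal.tendsto_ofReal t3)
    simp only [ENNReal.ofReal_zero, add_zero] at ht
    exact ht.eventually_lt_const ((ENNReal.ofReal_lt_ofReal_iff hϵ0).2 (by linarith))
  filter_upwards [eventually_gt_atTop 0, hKatop.eventually_gt_atTop 0, hclose hK hρ,
    hclose hKa hρ, hclose hN hσ0, hclose hE hρ, hK.eventually_le_const hμ.2, hsmall]
    with n hn hKapos c1 c2 c3 c4 hKn hlt
  set N := ⌊ν * Ka n⌋₊ with hNdef
  have hn' : (0 : ℝ) < n := by exact_mod_cast hn
  have hKa0 : 0 < Ka n := by exact_mod_cast hKapos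
  have hNν : (N : ℝ) ≤ ν * Ka n := Nat.floor_le (by positivity)
  have hNKa : N ≤ Ka n := by
    have : (N : ℝ) ≤ Ka n := hNν.trans (mul_le_of_le_one_left hKapos.le hν.2)
    exact_mod_cast this
  -- This uses `μ < 1`: once `K n ≤ n`, the prefactors `N + 1` and `K` are absorbed in the factors
  -- `n + 1` and `n` of `hsmall`.
  have hKn' : (K n : ℝ) ≤ n := by rwa [div_le_one hn'] at hKn
  have c3' := abs_lt.1 c3
  have hs : √((e₂ : ℝ) * k / n) ^ 2 = e₂ * k / n := Real.sq_sqrt (by positivity)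
  have hϵN : (Ka n : ℝ) - N ≤ (ϵ - σ) * Ka n := by
    have h1 : (N : ℝ) = N / Ka n * Ka n := by field_simp
    nlinarith
  have hsep : SeparationCondition n k (K n) (Ka n) N (√((e₂ : ℝ) * k / n) ^ 2) (ϵ - σ) η
      (η / 2) := by
    intro t m htm hmN hbad
    rw [hs]
    have htm' : (t : ℝ) ≤ m := by exact_mod_cast htm
    have hmN' : (m : ℝ) ≤ N := by exact_mod_cast hmN
    have e1 : ((m : ℝ) - t) / Ka n + t / Ka n = m / Ka n := by ring
    have e2 : (m : ℝ) / Ka n + 1 - N / Ka n = (m + (Ka n - N)) / Ka n := by field_simp; ring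
    have hmν : (m : ℝ) / Ka n ≤ ν := by rw [div_le_iff₀ hKapos]; linarith
    have hθ : ϵ - 1 + ν - ρ < t / Ka n := by
      have h1 : (ϵ - σ) < 1 - N / Ka n + t / Ka n := by
        rw [show 1 - (N : ℝ) / Ka n + t / Ka n = (Ka n - N + t) / Ka n by field_simp,
          lt_div_iff₀ hKapos]
        exact hbad
      linarith
    have hρη : |η| < ρ := by rw [abs_of_pos (by positivity), hη]; linarith
    -- The pair is `θ = t / Ka` and `ψ = (m - t) / Ka`. Rounding down in `N` ensures `m / Ka ≤ ν`,
    -- which is `ψ ≤ ν - θ` with the exact `ν`.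
    obtain ⟨g1, g2⟩ := hmargin (K n / n) (Ka n / K n) (N / Ka n) η (e₂ * k / n * Ka n) (t / Ka n)
      ((m - t) / Ka n) c1 c2 (c3.trans_le (by linarith)) hρη c4 hθ
      ((div_le_div_of_nonneg_right htm' hKapos.le).trans hmν)
      (div_nonneg (by linarith) hKapos.le) (by linarith)
    refine ⟨by positivity, ?_⟩
    rw [margin, e1, e2] at g2
    rw [show 2 * (η / 2) = η by ring, ← mul_assoc ((e₂ : ℝ) * k / n) (Ka n : ℝ),
      ← mul_assoc ((e₂ : ℝ) * k / n) (Ka n : ℝ)]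
    linarith
  refine existsCode_of_separationCondition (s := √((e₂ : ℝ) * k / n)) (r := r) (hC (K n)) hn hNKa
    (hKa_le n) hKa0 (by positivity) hϵN hsep hr1 ?_
    (ENNReal.ofReal_le_one.2 hϵ.le) (lt_of_le_of_lt ?_ hlt)
  · rw [hs, hr]
    refine le_of_eq ?_
    field_simp
  · have hNn : (N : ℝ) ≤ n :=
      le_trans (by exact_mod_cast hNKa.trans (hKa_le n)) hKn'
    gcongr
    rw [← ENNReal.ofReal_natCast, ← ENNReal.ofReal_mul (by positivity)]
    refine ENNReal.ofReal_le_ofReal ?_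
    push_cast
    nlinarith [mul_le_mul_of_nonneg_right hKn' (by positivity : 0 ≤ (2 : ℝ) ^ k * q ^ n)]

end MassiveAccess

end

/-! ### The achievability theorem. -/

theorem proposition1 (k : ℕ) (hk : 0 < k) (μ pa ϵ ν : ℝ)
    (hμ : μ ∈ Set.Ioo (0 : ℝ) 1) (hpa : pa ∈ Set.Ioc (0 : ℝ) 1) (hϵ : ϵ ∈ Set.Ioc (0 : ℝ) 1)
    (hν : ν ∈ Set.Ioc (1 - ϵ) 1)
    (K Ka : ℕ → ℕ) (hKa_le : ∀ n, Ka n ≤ K n)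
    (hK : Tendsto (fun n : ℕ => (K n : ℝ) / (n : ℝ)) atTop (𝓝 μ))
    (hKa : Tendsto (fun n : ℕ => (Ka n : ℝ) / (K n : ℝ)) atTop (𝓝 pa)) :
    (∀ e : ℝ≥0, MassiveAccess.csirThreshold k μ pa ϵ ν < (e : ℝ≥0∞) →
      ∃ ϵseq : ℕ → ℝ≥0∞,
        (∀ n, MassiveAccess.ExistsCode n k (ϵseq n) e (K n) (Ka n)) ∧
        limsup ϵseq atTop ≤ ENNReal.ofReal ϵ) ∧
    MassiveAccess.minEnergyPerBit k K Ka (ENNReal.ofReal ϵ)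
      ≤ MassiveAccess.csirThreshold k μ pa ϵ ν := by
  classical
  have key : ∀ e : ℝ≥0, MassiveAccess.csirThreshold k μ pa ϵ ν < (e : ℝ≥0∞) →
      ∀ᶠ n in atTop, MassiveAccess.ExistsCode n k (ENNReal.ofReal ϵ) e (K n) (Ka n) := by
    intro e he
    rcases hϵ.2.eq_or_lt with rfl | hϵ1
    · rw [ENNReal.ofReal_one]
      exact Eventually.of_forall fun n => MassiveAccess.existsCode_one (hKa_le n) e
    · exact MassiveAccess.eventually_existsCode hk hμ hpa hϵ.1 hϵ1 hν hKa_le hK hKa he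
  -- A code is required at every `n`, so the finitely many blocklengths that may fail the target get
  -- the trivial error level `1`, which does not affect the upper limit.
  refine ⟨fun e he => ⟨fun n => if MassiveAccess.ExistsCode n k (ENNReal.ofReal ϵ) e (K n) (Ka n)
    then ENNReal.ofReal ϵ else 1, fun n => ?_, ?_⟩, ?_⟩
  · dsimp only
    split_ifs with h
    · exact h
    · exact MassiveAccess.existsCode_one (hKa_le n) e
  · refine limsup_le_of_le (by isBoundedDefault) ?_
    filter_upwards [key e he] with n hn
    rw [if_pos hn]
  · refine ENNReal.le_of_forall_pos_le_add fun δ hδ hfin => ?_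
    obtain ⟨e, he, heδ⟩ := ENNReal.lt_iff_exists_nnreal_btwn.1
      (ENNReal.lt_add_right hfin.ne (ENNReal.coe_ne_zero.2 hδ.ne'))
    refine le_trans (limsup_le_of_le (by isBoundedDefault) ?_) heδ.le
    filter_upwards [key e he] with n hn
    exact iInf₂_le e hn
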